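/- **Theorem 4.2.** Let $J$ be a bounded half line Jacobi matrix on $\ell_2(\mathbb Z_+)$, $\mathbb Z_+=\{1,2,\dots\}$, $(Ju)(n)=a(n)u(n+1)+a(n-1)u(n-1)+b(n)u(n)$ (with $u(0)=0$), whose coefficients satisfy $(C+1)^{-1}\le a(n)\le C+1$ and $|b(n)|\le C$ ($n\ge 1$) for some $C>0$; put $a(0)=1$. For $z\in\mathbb C^+=\{\operatorname{Im}z>0\}$ let $m_+(z)=\langle\delta_1,(J-z)^{-1}\delta_1\rangle$, let $f_+(n,z)$ be the solution of $a(n)f(n+1)+a(n-1)f(n-1)+b(n)f(n)=zf(n)$ ($n\ge1$) with $f_+(0,z)=1$, $f_+(1,z)=-m_+(z)$, and define $$m_+(n,z)=-\frac{f_+(n+1,z)}{a(n)f_+(n,z)},\qquad w_+^{(N)}(z)=\frac1N\sum_{n=1}^N\ln\left[a(n)m_+(n,z)\right],$$ where $\operatorname{Im}\ln\zeta\in(0,\pi)$ for $\zeta\in\mathbb C^+$. Let $N_j\to\infty$ be a sequence of positive integers such that $w_+^{(N_j)}$ converges, uniformly on compact subsets of $\mathbb C^+$, to a holomorphic function $w_+:\mathbb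 C^+\to\mathbb C^+$, and write $w_+(z)=-\gamma(z)+i\pi k(z)$ with real $\gamma,k$. Then the limits $\gamma(t)=\lim_{y\to0+}\gamma(t+iy)$ (the Lyapunov exponent along $(N_j)$) and $k(t)=\lim_{y\to0+}k(t+iy)$ exist and are finite for every $t\in\mathbb R$, $\gamma$ is a measurable function on $\mathbb R$, and $k$ is increasing and right-continuous on $\mathbb R$ and thus determines a measure $dk$ (the density of states measure), which is a probability measure. Put $g(z)=\int_{\mathbb R}\frac{dk(t)}{t-z}$ for $z\in\mathbb C^+$. Then for Lebesgue almost every $x\in\mathbb R$, the limit $g(x)=\lim_{y\to0+}g(x+iy)$ exists, and $\gamma$ is approximately differentiable at $x$ with approximate derivative $-\operatorname{Re}g(x)$; that is, for every $\epsilon>0$, $$\lim_{h\to0+}\frac1{2h}\left|\left\{y\in(-h,h):\left|\frac{\gamma(x+y)-\gamma(x)}{y}+\operatorname{Re}g(x)\right| \ge\epsilon\right\}\right|=0 .$$ -/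

import Mathlib

open Filter Topology MeasureTheory

/-- The coefficients of a bounded half line Jacobi matrix
`(J u)(n) = a(n) u(n+1) + a(n-1) u(n-1) + b(n) u(n)`, `n = 1, 2, 3, …`.
The value `a 0 = 1` is a convention that is used for solutions of the difference equation;
`b 0` plays no role. -/
structure BoundedJacobi where
  a : ℕ → ℝ
  b : ℕ → ℝ
  a_zero : a 0 = 1
  bounded : ∃ C : ℝ, 0 < C ∧ ∀ n : ℕ, 1 ≤ n → (C + 1)⁻¹ ≤ a n ∧ a n ≤ C + 1 ∧ |b n| ≤ C

/-- The Hilbert space `ℓ²(ℤ₊)`, `ℤ₊ = {1, 2, 3, …}`. The component with index `i : ℕ` belongs to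
the site `n = i + 1`. -/
abbrev EllTwo : Type := lp (fun _ : ℕ => ℂ) 2

namespace BoundedJacobi

/-- The action of the Jacobi matrix on sequences, with `u(0) = 0` (the component with index `i`
belongs to the site `i + 1`). -/
def act (J : BoundedJacobi) (u : ℕ → ℂ) : ℕ → ℂ
  | 0 => (J.a 1 : ℂ) * u 1 + (J.b 1 : ℂ) * u 0
  | i + 1 => (J.a (i + 2) : ℂ) * u (i + 2) + (J.a (i + 1) : ℂ) * u i + (J.b (i + 2) : ℂ) * u (i + 1)

theorem act_add (J : BoundedJacobi) (u v : ℕ → ℂ) : J.act (u + v) = J.act u + J.act v := by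
  funext i
  cases i <;> simp only [act, Pi.add_apply] <;> ring

theorem act_smul (J : BoundedJacobi) (c : ℂ) (u : ℕ → ℂ) : J.act (c • u) = c • J.act u := by
  funext i
  cases i <;> simp only [act, Pi.smul_apply, smul_eq_mul] <;> ring

theorem memℓp_mul {c : ℕ → ℝ} {u : ℕ → ℂ} {M : ℝ} (hc : ∀ i, |c i| ≤ M)
    (hu : Memℓp u 2) : Memℓp (fun i => (c i : ℂ) * u i) 2 := by
  have h2 : (0 : ℝ) < (2 : ENNReal).toReal := by norm_num
  rw [memℓp_gen_iff h2] at hu ⊢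
  norm_num at hu ⊢
  refine Summable.of_nonneg_of_le (fun i => by positivity) (fun i => ?_) (hu.mul_left (M ^ 2))
  rw [mul_pow]
  refine mul_le_mul_of_nonneg_right ?_ (by positivity)
  exact sq_le_sq.2 (by rw [abs_abs]; exact (hc i).trans (le_abs_self M))

theorem memℓp_act (J : BoundedJacobi) {u : ℕ → ℂ} (hu : Memℓp u 2) : Memℓp (J.act u) 2 := by
  obtain ⟨C, hC, h⟩ := J.bounded
  have ha : ∀ i : ℕ, |J.a (i + 1)| ≤ C + 1 := fun i => by
    obtain ⟨h1, h2, -⟩ := h (i + 1) (by omega)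
    have : (0 : ℝ) < (C + 1)⁻¹ := by positivity
    rw [abs_le]; constructor <;> linarith
  have hb : ∀ i : ℕ, |J.b (i + 1)| ≤ C := fun i => (h (i + 1) (by omega)).2.2
  have h2 : (0 : ℝ) < (2 : ENNReal).toReal := by norm_num
  have s1 : Memℓp (fun i => u (i + 1)) 2 := by
    rw [memℓp_gen_iff h2] at hu ⊢
    exact (summable_nat_add_iff (f := fun i => ‖u i‖ ^ (2 : ENNReal).toReal) 1).2 hu
  have t1 := memℓp_mul (c := fun i => J.a (i + 1)) ha s1
  have t3 := memℓp_mul (c := fun i => J.b (i + 1)) hb hu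
  have t2 : Memℓp (fun i : ℕ => if i = 0 then (0 : ℂ) else (J.a i : ℂ) * u (i - 1)) 2 := by
    have := memℓp_mul (c := fun i => J.a (i + 1)) ha hu
    rw [memℓp_gen_iff h2] at this ⊢
    refine (summable_nat_add_iff 1).1 ?_
    simpa using this
  have := (t1.add t2).add t3
  convert this using 1
  funext i
  cases i <;> simp [act]

/-- The Jacobi matrix as a linear operator on `ℓ²(ℤ₊)`. -/
def linearOp (J : BoundedJacobi) : EllTwo →ₗ[ℂ] EllTwo where
  toFun u := ⟨J.act u, J.memℓp_act u.2⟩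
  map_add' u v := Subtype.ext (J.act_add u v)
  map_smul' c u := Subtype.ext (J.act_smul c u)

/-- The Jacobi matrix as a bounded operator on `ℓ²(ℤ₊)`; the continuity is obtained from the closed
graph theorem. -/
def op (J : BoundedJacobi) : EllTwo →L[ℂ] EllTwo where
  toLinearMap := J.linearOp
  cont := by
    refine J.linearOp.continuous_of_seq_closed_graph fun u x y hu hy => ?_
    have ev : ∀ i : ℕ, Continuous fun v : EllTwo => v i := fun i =>
      (lp.evalCLM ℂ (fun _ : ℕ => ℂ) (2 : ENNReal) i).continuous
    have hx : ∀ i, Tendsto (fun n => u n i) atTop (𝓝 (x i)) := fun i =>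
      ((ev i).tendsto x).comp hu
    ext i
    have h1 : Tendsto (fun n => J.act (u n) i) atTop (𝓝 (y i)) := ((ev i).tendsto y).comp hy
    have h2 : Tendsto (fun n => J.act (u n) i) atTop (𝓝 (J.act x i)) := by
      cases i with
      | zero => exact ((hx _).const_mul _).add ((hx _).const_mul _)
      | succ i => exact (((hx _).const_mul _).add ((hx _).const_mul _)).add ((hx _).const_mul _)
    exact tendsto_nhds_unique h1 h2

theorem op_apply (J : BoundedJacobi) (u : EllTwo) (i : ℕ) : J.op u i = J.act u i := rfl

/-- The Titchmarsh-Weyl function `m₊(z) = ⟨δ₁, (J - z)⁻¹ δ₁⟩`. -/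
noncomputable def mPlus (J : BoundedJacobi) (z : ℂ) : ℂ :=
  inner ℂ (lp.single 2 0 (1 : ℂ) : EllTwo)
    (Ring.inverse (J.op - algebraMap ℂ (EllTwo →L[ℂ] EllTwo) z) (lp.single 2 0 (1 : ℂ)))

/-- The solution `f₊(n, z)` of `a(n) f(n+1) + a(n-1) f(n-1) + b(n) f(n) = z f(n)`, `n ≥ 1`, with
`f₊(0, z) = 1` and `f₊(1, z) = -m₊(z)`. -/
noncomputable def fPlus (J : BoundedJacobi) (z : ℂ) : ℕ → ℂ
  | 0 => 1
  | 1 => -J.mPlus z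
  | n + 2 => ((z - (J.b (n + 1) : ℂ)) * J.fPlus z (n + 1) - (J.a n : ℂ) * J.fPlus z n)
      / (J.a (n + 1) : ℂ)

/-- The functions `m₊(n, z) = - f₊(n+1, z) / (a(n) f₊(n, z))`. -/
noncomputable def mPlusAt (J : BoundedJacobi) (n : ℕ) (z : ℂ) : ℂ :=
  -(J.fPlus z (n + 1) / ((J.a n : ℂ) * J.fPlus z n))

/-- `w₊^{(N)}(z) = (1/N) ∑_{n=1}^N ln (a(n) m₊(n, z))`. For `z ∈ ℂ⁺` the arguments of the logarithm
lie in `ℂ⁺`, where the principal branch satisfies `Im ln ∈ (0, π)`. -/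
noncomputable def wPlus (J : BoundedJacobi) (N : ℕ) (z : ℂ) : ℂ :=
  (1 / (N : ℂ)) * ∑ n ∈ Finset.Icc 1 N, Complex.log ((J.a n : ℂ) * J.mPlusAt n z)

end BoundedJacobi

/-- The open upper half plane `ℂ⁺`. -/
def upperHalf : Set ℂ := {z | 0 < z.im}

/-- Herglotz functions: holomorphic maps of `ℂ⁺` to itself. -/
def IsHerglotz (F : ℂ → ℂ) : Prop :=
  DifferentiableOn ℂ F upperHalf ∧ Set.MapsTo F upperHalf upperHalf

/-- `w` is a Herglotz function and `w₊^{(N j)} → w` uniformly on compact subsets of `ℂ⁺`. -/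
def BoundedJacobi.IsLimitWPlus (J : BoundedJacobi) (N : ℕ → ℕ) (w : ℂ → ℂ) : Prop :=
  IsHerglotz w ∧
    ∀ K : Set ℂ, K ⊆ upperHalf → IsCompact K →
      TendstoUniformlyOn (fun j => J.wPlus (N j)) w atTop K

/-- Writing `w = -γ + iπk` on `ℂ⁺`, the function `γ` on `ℝ` consists of the boundary values
`γ(t) = lim_{y → 0+} γ(t + iy)`, for every `t`. -/
def IsLyapunovExponent (w : ℂ → ℂ) (γ : ℝ → ℝ) : Prop :=
  ∀ t : ℝ, Tendsto (fun y : ℝ => -(w (t + y * Complex.I)).re) (𝓝[>] 0) (𝓝 (γ t))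

/-- Writing `w = -γ + iπk` on `ℂ⁺`, the increasing function `k` on `ℝ` consists of the boundary
values `k(t) = lim_{y → 0+} k(t + iy)`, for every `t`. The density of states measure `dk` is then
`k.measure`. -/
def IsIntegratedDensityOfStates (w : ℂ → ℂ) (k : StieltjesFunction ℝ) : Prop :=
  ∀ t : ℝ, Tendsto (fun y : ℝ => (w (t + y * Complex.I)).im / Real.pi) (𝓝[>] 0) (𝓝 (k t))

/-- The Borel transform `∫ dμ(t) / (t - z)`. -/
noncomputable def borelTransform (μ : Measure ℝ) (z : ℂ) : ℂ :=
  ∫ t : ℝ, 1 / ((t : ℂ) - z) ∂μ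

/-- `f` is approximately differentiable at `x`, with approximate derivative `d`. -/
def HasApproxDerivAt (f : ℝ → ℝ) (d x : ℝ) : Prop :=
  ∀ ε : ℝ, 0 < ε →
    Tendsto (fun h : ℝ => 1 / (2 * h) *
        volume.real {y : ℝ | y ∈ Set.Ioo (-h) h ∧ ε ≤ |(f (x + y) - f x) / y - d|})
      (𝓝[>] 0) (𝓝 0)

/-! The proof reduces the statement to a fact about logarithmic potentials on the line.

Spectral side. Under the derivative, the sum defining `w₊^{(N)}` telescopes to logarithmic
derivatives of `f₊(N+1)` and `f₊(1)`. The Wronskian of `f₊` with the orthogonal polynomials `p` is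
constant, so `f₊(N+1) p(N+1) H` is constant for a Herglotz function `H`. The logarithmic derivative
of a Herglotz function at `z` is at most a constant over `Im z` (`norm_logDeriv_le`). Hence the
derivative of `w₊^{(N)}` is the Borel transform of the normalized zero counting measure of `p(N+1)`,
up to `O(1/N)`. The zeros lie in a fixed bounded interval, so a weak limit `ν` exists, and `w = c -
∫ log(t - z) dν(t)` on the upper half plane (`exists_hasDerivAt_limit`). Since `f₊` is square
summable, `Re w ≤ 0`. This bounds the potential of `ν` from below, so `ν` has no atoms and the
monotone limits defining `γ` are finite. The bounds `0 ≤ Im w ≤ π` force `Im c = 0`, so that `k` is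
the distribution function of `ν`.

Real variable side. Let `F` be the closed set of points at which all difference quotients of `k` are
bounded by `n`. As `k` is monotone, hence differentiable almost everywhere, these sets exhaust
almost all of the line. Let `K` be a Lipschitz extension of `k` from `F`, and `u = k - K`. After
integration by parts, up to an additive constant, `γ(x)` equals on `F` the logarithmic potential of
the bounded density `K'` minus `∫ u(s)/(s - x) ds`.

The first term is differentiable almost everywhere: a contour integral of the squared Cauchy
transform shows that it has locally bounded variation, and comparison with the conjugate Poisson
integral identifies the derivative (`ae_tendsto_cauchy`). For the second, `|u| ≤ 2n dist(·, F)`, so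
the Marcinkiewicz integral `∫ |u(s)|/(s - x)² ds` is finite for almost every `x` in `F`. At such
points that are also density points of `F`, the second term is differentiable within `F`
(`hasDerivWithinAt_integral`). A derivative within `F` at a density point of `F` is an approximate
derivative. -/

/-! ### Borel transforms and logarithmic potentials on the upper half plane -/

theorem sub_mem_slitPlane_of_im_pos (t : ℝ) {z : ℂ} (hz : 0 < z.im) :
    (t : ℂ) - z ∈ Complex.slitPlane := by
  rw [Complex.mem_slitPlane_iff]
  right
  simp [hz.ne']

theorem sub_ne_zero_of_im_pos (t : ℝ) {z : ℂ} (hz : 0 < z.im) : (t : ℂ) - z ≠ 0 :=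
  Complex.slitPlane_ne_zero (sub_mem_slitPlane_of_im_pos t hz)

theorem im_le_norm_sub (t : ℝ) {z : ℂ} (hz : 0 < z.im) : z.im ≤ ‖(t : ℂ) - z‖ := by
  have := Complex.abs_im_le_norm ((t : ℂ) - z)
  simpa [abs_of_pos hz] using this

theorem norm_inv_sub_le (t : ℝ) {z : ℂ} (hz : 0 < z.im) : ‖((t : ℂ) - z)⁻¹‖ ≤ z.im⁻¹ := by
  rw [norm_inv]
  exact inv_anti₀ hz (im_le_norm_sub t hz)

theorem hasDerivAt_inv_sub (t : ℝ) {z : ℂ} (hz : 0 < z.im) :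
    HasDerivAt (fun z : ℂ => ((t : ℂ) - z)⁻¹) ((((t : ℂ) - z) ^ 2)⁻¹) z := by
  have := ((hasDerivAt_id z).const_sub (t : ℂ)).fun_inv (sub_ne_zero_of_im_pos t hz)
  simpa using this

theorem hasDerivAt_log_sub (t : ℝ) {z : ℂ} (hz : 0 < z.im) :
    HasDerivAt (fun z : ℂ => Complex.log ((t : ℂ) - z)) (-((t : ℂ) - z)⁻¹) z := by
  have := ((hasDerivAt_id z).const_sub (t : ℂ)).clog (sub_mem_slitPlane_of_im_pos t hz)
  simpa [div_eq_mul_inv] using this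

theorem continuous_log_sub {z : ℂ} (hz : 0 < z.im) :
    Continuous fun t : ℝ => Complex.log ((t : ℂ) - z) :=
  (Complex.continuous_ofReal.sub continuous_const).clog
    fun t => sub_mem_slitPlane_of_im_pos t hz

theorem continuous_inv_sub {z : ℂ} (hz : 0 < z.im) :
    Continuous fun t : ℝ => ((t : ℂ) - z)⁻¹ :=
  (Complex.continuous_ofReal.sub continuous_const).inv₀ fun t => sub_ne_zero_of_im_pos t hz

theorem half_im_lt_of_mem_ball {z₀ z : ℂ} 
    (hz : z ∈ Metric.ball z₀ (z₀.im / 2)) : z₀.im / 2 < z.im := by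
  have h1 : ‖z - z₀‖ < z₀.im / 2 := by simpa [dist_eq_norm] using hz
  have h2 := (Complex.abs_im_le_norm (z - z₀)).trans_lt h1
  rw [abs_lt] at h2
  simp at h2
  linarith [h2.1]

section

variable {μ : Measure ℝ} {f : ℝ → ℂ} {R : ℝ}

theorem integrable_mul_inv_sub (hf : Integrable f μ) {z : ℂ} (hz : 0 < z.im) :
    Integrable (fun t : ℝ => f t * ((t : ℂ) - z)⁻¹) μ :=
  hf.mul_bdd (c := z.im⁻¹) (continuous_inv_sub hz).aestronglyMeasurable
    (Eventually.of_forall fun t => norm_inv_sub_le t hz)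

/-- The logarithm is unbounded at infinity, hence the condition of bounded support. A density
against a general measure covers both Lebesgue measure with a density and a probability measure with
`f = 1`. -/
theorem integrable_mul_log_sub (hf : Integrable f μ) (hR : ∀ᵐ t ∂μ, f t ≠ 0 → |t| ≤ R)
    {z : ℂ} (hz : 0 < z.im) :
    Integrable (fun t : ℝ => f t * Complex.log ((t : ℂ) - z)) μ := by
  obtain ⟨C, hC⟩ := (isCompact_Icc (a := -R) (b := R)).exists_bound_of_continuousOn
    (continuous_log_sub hz).continuousOn
  refine (hf.norm.mul_const C).mono'
    (hf.aestronglyMeasurable.mul (continuous_log_sub hz).aestronglyMeasurable) ?_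
  filter_upwards [hR] with t ht
  rw [norm_mul]
  by_cases h0 : f t = 0
  · simp [h0]
  · exact mul_le_mul_of_nonneg_left (hC t (abs_le.1 (ht h0))) (norm_nonneg _)

theorem hasDerivAt_integral_inv_sub (hf : Integrable f μ) {z : ℂ} (hz : 0 < z.im) :
    HasDerivAt (fun z : ℂ => ∫ t, f t * ((t : ℂ) - z)⁻¹ ∂μ)
      (∫ t, f t * (((t : ℂ) - z) ^ 2)⁻¹ ∂μ) z := by
  have hz2 : 0 < z.im / 2 := by positivity
  refine (hasDerivAt_integral_of_dominated_loc_of_deriv_le (μ := μ)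
    (F := fun z t => f t * ((t : ℂ) - z)⁻¹) (F' := fun z t => f t * (((t : ℂ) - z) ^ 2)⁻¹)
    (bound := fun t => ‖f t‖ * ((z.im / 2)⁻¹ ^ 2))
    (Metric.ball_mem_nhds z hz2) ?_ (integrable_mul_inv_sub hf hz) ?_ ?_ ?_ ?_).2
  · filter_upwards [Metric.ball_mem_nhds z hz2] with y hy
    exact (integrable_mul_inv_sub hf (hz2.trans (half_im_lt_of_mem_ball hy))).1
  · refine hf.1.mul ?_
    exact (((continuous_inv_sub hz).pow 2).congr fun t => inv_pow _ _).aestronglyMeasurable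
  · refine Eventually.of_forall fun t y hy => ?_
    have h1 := half_im_lt_of_mem_ball hy
    rw [norm_mul, ← inv_pow, norm_pow]
    gcongr
    exact (norm_inv_sub_le t (hz2.trans h1)).trans (inv_anti₀ hz2 h1.le)
  · exact hf.norm.mul_const _
  · refine Eventually.of_forall fun t y hy => ?_
    exact (hasDerivAt_inv_sub t (hz2.trans (half_im_lt_of_mem_ball hy))).const_mul _

theorem hasDerivAt_integral_log_sub (hf : Integrable f μ) (hR : ∀ᵐ t ∂μ, f t ≠ 0 → |t| ≤ R)
    {z : ℂ} (hz : 0 < z.im) :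
    HasDerivAt (fun z : ℂ => ∫ t, f t * Complex.log ((t : ℂ) - z) ∂μ)
      (-∫ t, f t * ((t : ℂ) - z)⁻¹ ∂μ) z := by
  have hz2 : 0 < z.im / 2 := by positivity
  rw [← integral_neg]
  refine (hasDerivAt_integral_of_dominated_loc_of_deriv_le (μ := μ)
    (F := fun z t => f t * Complex.log ((t : ℂ) - z)) (F' := fun z t => -(f t * ((t : ℂ) - z)⁻¹))
    (bound := fun t => ‖f t‖ * ((z.im / 2)⁻¹))
    (Metric.ball_mem_nhds z hz2) ?_ (integrable_mul_log_sub hf hR hz) ?_ ?_ ?_ ?_).2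
  · filter_upwards [Metric.ball_mem_nhds z hz2] with y hy
    exact (integrable_mul_log_sub hf hR (hz2.trans (half_im_lt_of_mem_ball hy))).1
  · exact (integrable_mul_inv_sub hf hz).1.neg
  · refine Eventually.of_forall fun t y hy => ?_
    have h1 := half_im_lt_of_mem_ball hy
    rw [norm_neg, norm_mul]
    gcongr
    exact (norm_inv_sub_le t (hz2.trans h1)).trans (inv_anti₀ hz2 h1.le)
  · exact hf.norm.mul_const _
  · refine Eventually.of_forall fun t y hy => ?_
    have := (hasDerivAt_log_sub t (hz2.trans (half_im_lt_of_mem_ball hy))).const_mul (f t)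
    simpa using this

end

/-! ### Lebesgue points and dilated kernels -/

/-- `x` is a Lebesgue point of `f`. -/
def IsLebesguePoint (f : ℝ → ℝ) (x : ℝ) : Prop :=
  Tendsto (fun r : ℝ => ⨍ y in Metric.closedBall x r, ‖f y - f x‖) (𝓝[>] 0) (𝓝 0)

theorem ae_isLebesguePoint {f : ℝ → ℝ} (hf : LocallyIntegrable f) :
    ∀ᵐ x, IsLebesguePoint f x := by
  filter_upwards [IsUnifLocDoublingMeasure.ae_tendsto_average_norm_sub volume hf 1] with x hx
  refine hx (fun _ => x) (fun r => r) tendsto_id ?_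
  filter_upwards [self_mem_nhdsWithin] with r hr
  simpa using (le_of_lt hr : (0 : ℝ) ≤ r)

theorem integral_comp_affine (F : ℝ → ℝ) (x : ℝ) {h : ℝ} (hh : 0 < h) :
    ∫ τ, F (x + h * τ) = h⁻¹ * ∫ t, F t := by
  have := Measure.integral_comp_mul_left (fun s => F (x + s)) h
  rw [this, integral_add_left_eq_self F x, abs_of_pos (inv_pos.2 hh), smul_eq_mul]

/-- The substitution `y = x + hτ` turns the average over the ball of radius `hT` into an integral
over a fixed ball, up to the factor `2T`. -/
theorem IsLebesguePoint.tendsto_setIntegral {f : ℝ → ℝ} {x : ℝ} (hx : IsLebesguePoint f x)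
    {T : ℝ} (hT : 0 < T) :
    Tendsto (fun h : ℝ => ∫ τ in Metric.closedBall 0 T, ‖f (x + h * τ) - f x‖) (𝓝[>] 0) (𝓝 0) := by
  have h1 : Tendsto (fun h : ℝ => h * T) (𝓝[>] 0) (𝓝[>] 0) := by
    refine tendsto_nhdsWithin_iff.2 ⟨?_, ?_⟩
    · have : Tendsto (fun h : ℝ => h * T) (𝓝 0) (𝓝 (0 * T)) := tendsto_id.mul_const T
      rw [zero_mul] at this
      exact this.mono_left nhdsWithin_le_nhds
    · filter_upwards [self_mem_nhdsWithin] with h hh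
      exact mul_pos hh hT
  have h2 := (hx.comp h1).const_mul (2 * T)
  rw [mul_zero] at h2
  refine h2.congr' ?_
  filter_upwards [self_mem_nhdsWithin] with h hh
  have hh : 0 < h := hh
  simp only [Function.comp]
  rw [setAverage_eq, measureReal_def, Real.volume_closedBall,
    ENNReal.toReal_ofReal (by positivity), smul_eq_mul,
    ← integral_indicator Metric.isClosed_closedBall.measurableSet,
    ← integral_indicator Metric.isClosed_closedBall.measurableSet]
  have := integral_comp_affine
    (Set.indicator (Metric.closedBall x (h * T)) fun y => ‖f y - f x‖) x hh
  have e : ∀ τ : ℝ, (Metric.closedBall x (h * T)).indicator (fun y => ‖f y - f x‖) (x + h * τ)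
      = (Metric.closedBall 0 T).indicator (fun τ => ‖f (x + h * τ) - f x‖) τ := by
    intro τ
    have : x + h * τ ∈ Metric.closedBall x (h * T) ↔ τ ∈ Metric.closedBall (0 : ℝ) T := by
      simp [abs_of_pos hh, mul_le_mul_iff_right₀ hh]
    by_cases hτ : τ ∈ Metric.closedBall (0 : ℝ) T
    · rw [Set.indicator_of_mem hτ, Set.indicator_of_mem (this.2 hτ)]
    · rw [Set.indicator_of_notMem hτ, Set.indicator_of_notMem (this.not.2 hτ)]
  simp_rw [e] at this
  rw [this]
  field_simp

/-- Convergence of averages of a bounded function against dilations of an integrable kernel, at a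
Lebesgue point. -/
theorem IsLebesguePoint.tendsto_integral_mul {f κ : ℝ → ℝ} {x M : ℝ} (hx : IsLebesguePoint f x)
    (hfm : Measurable f) (hfM : ∀ t, |f t| ≤ M) (hκ : Integrable κ) :
    Tendsto (fun h : ℝ => ∫ τ, f (x + h * τ) * κ τ) (𝓝[>] 0) (𝓝 (f x * ∫ τ, κ τ)) := by
  have hM : 0 ≤ M := (abs_nonneg _).trans (hfM x)
  -- On `A n` the kernel is at most `n` and `τ` stays in a fixed ball, so the Lebesgue point
  -- property applies. The complement carries little of the mass of `κ`, and there boundedness of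
  -- `f` suffices. Thus `κ` needs no radially decreasing majorant, which the kernel `logKernel`,
  -- with its interior singularities, does not have.
  let A : ℕ → Set ℝ := fun n => {τ | ‖κ τ‖ ≤ n} ∩ Metric.closedBall 0 n
  have hA : ∀ n, NullMeasurableSet (A n) := fun n =>
    (nullMeasurableSet_le hκ.1.norm.aemeasurable aemeasurable_const).inter
      Metric.isClosed_closedBall.measurableSet.nullMeasurableSet
  have hlim : Tendsto (fun n : ℕ => ∫ τ in (A n)ᶜ, ‖κ τ‖) atTop (𝓝 0) := by
    have h0 : ∀ n, ∫ τ in (A n)ᶜ, ‖κ τ‖ = ∫ τ, (A n)ᶜ.indicator (fun τ => ‖κ τ‖) τ := fun n =>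
      (integral_indicator₀ (hA n).compl).symm
    simp_rw [h0]
    rw [← integral_zero ℝ ℝ (μ := volume)]
    refine tendsto_integral_of_dominated_convergence (fun τ => ‖κ τ‖) (fun n => ?_) hκ.norm
      (fun n => Eventually.of_forall fun τ => ?_) (Eventually.of_forall fun τ => ?_)
    · exact hκ.1.norm.indicator₀ (hA n).compl
    · rw [Real.norm_eq_abs, abs_of_nonneg (Set.indicator_nonneg (fun _ _ => norm_nonneg _) _)]
      exact Set.indicator_le_self' (fun _ _ => norm_nonneg _) _
    · refine tendsto_const_nhds.congr' ?_
      obtain ⟨n, hn⟩ := exists_nat_ge (max ‖κ τ‖ |τ|)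
      filter_upwards [eventually_ge_atTop n] with m hm
      have hm' : (n : ℝ) ≤ m := by exact_mod_cast hm
      refine (Set.indicator_of_notMem ?_ _).symm
      simp only [A, Set.mem_compl_iff, not_not]
      refine ⟨?_, ?_⟩
      · exact ((le_max_left _ _).trans hn).trans hm'
      · simpa using ((le_max_right _ _).trans hn).trans hm'
  rw [Metric.tendsto_nhds]
  intro ε hε
  have hev : ∀ᶠ n : ℕ in atTop, 2 * M * ∫ τ in (A n)ᶜ, ‖κ τ‖ < ε / 2 := by
    have := hlim.const_mul (2 * M)
    rw [mul_zero] at this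
    exact this.eventually (gt_mem_nhds (by positivity))
  obtain ⟨n, hn, hn1⟩ := (hev.and (eventually_ge_atTop 1)).exists
  have hn0 : (0 : ℝ) < n := by exact_mod_cast hn1
  have hB := (hx.tendsto_setIntegral hn0).const_mul (n : ℝ)
  rw [mul_zero] at hB
  filter_upwards [hB.eventually (gt_mem_nhds (show 0 < ε / 2 by positivity)),
    self_mem_nhdsWithin] with h hh hpos
  have hfh : Measurable fun τ => f (x + h * τ) := hfm.comp (by fun_prop)
  have i1 : Integrable fun τ => f (x + h * τ) * κ τ :=
    hκ.bdd_mul (c := M) hfh.aestronglyMeasurable (Eventually.of_forall fun τ => hfM _)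
  have i2 : Integrable fun τ => (f (x + h * τ) - f x) * κ τ := by
    exact (i1.sub (hκ.const_mul (f x))).congr (Eventually.of_forall fun τ => (sub_mul _ _ _).symm)
  have hd : ∀ τ, ‖f (x + h * τ) - f x‖ ≤ 2 * M := fun τ => by
    have := abs_sub (f (x + h * τ)) (f x)
    rw [Real.norm_eq_abs]
    linarith [hfM (x + h * τ), hfM x]
  rw [dist_eq_norm, ← integral_const_mul, ← integral_sub i1 (hκ.const_mul _)]
  calc ‖∫ τ, (f (x + h * τ) * κ τ - f x * κ τ)‖
      ≤ ∫ τ, ‖(f (x + h * τ) - f x) * κ τ‖ := by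
        simp_rw [← sub_mul]
        exact norm_integral_le_integral_norm _
    _ = (∫ τ in A n, ‖(f (x + h * τ) - f x) * κ τ‖)
        + ∫ τ in (A n)ᶜ, ‖(f (x + h * τ) - f x) * κ τ‖ :=
        (integral_add_compl₀ (hA n) i2.norm).symm
    _ ≤ (n * ∫ τ in Metric.closedBall 0 (n : ℝ), ‖f (x + h * τ) - f x‖)
        + 2 * M * ∫ τ in (A n)ᶜ, ‖κ τ‖ := by
        gcongr
        · rw [← integral_const_mul]
          have i3 : IntegrableOn (fun τ => (n : ℝ) * ‖f (x + h * τ) - f x‖)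
              (Metric.closedBall 0 (n : ℝ)) := by
            refine Integrable.mono' (g := fun _ => n * (2 * M))
              (integrableOn_const measure_closedBall_lt_top.ne) ?_ ?_
            · exact ((hfh.sub_const _).norm.const_mul _).aestronglyMeasurable
            · refine Eventually.of_forall fun τ => ?_
              rw [norm_mul, norm_norm, Real.norm_natCast]
              exact mul_le_mul_of_nonneg_left (hd τ) hn0.le
          calc ∫ τ in A n, ‖(f (x + h * τ) - f x) * κ τ‖
              ≤ ∫ τ in A n, (n : ℝ) * ‖f (x + h * τ) - f x‖ := by
                refine setIntegral_mono_on₀ i2.norm.integrableOn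
                  (i3.mono_set Set.inter_subset_right) (hA n) fun τ hτ => ?_
                rw [norm_mul, mul_comm]
                exact mul_le_mul_of_nonneg_right hτ.1 (norm_nonneg _)
            _ ≤ _ := setIntegral_mono_set i3
                (Eventually.of_forall fun τ => by positivity)
                (Eventually.of_forall fun τ hτ => hτ.2)
        · rw [← integral_const_mul]
          refine integral_mono i2.norm.integrableOn (hκ.norm.integrableOn.const_mul _) fun τ => ?_
          simp only [norm_mul]
          exact mul_le_mul_of_nonneg_right (hd τ) (norm_nonneg _)
    _ < ε / 2 + ε / 2 := add_lt_add hh hn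
    _ = ε := by ring

/-! ### Potentials and Cauchy transforms of bounded densities -/

/-- A bounded measurable function on `ℝ` with bounded support. -/
structure IsBoundedDensity (f : ℝ → ℝ) (M R : ℝ) : Prop where
  measurable : Measurable f
  bound : ∀ t, |f t| ≤ M
  support : ∀ t, f t ≠ 0 → |t| ≤ R

namespace IsBoundedDensity

variable {f : ℝ → ℝ} {M R : ℝ}

theorem integrable_mul (hf : IsBoundedDensity f M R) {g : ℝ → ℝ}
    (hg : IntegrableOn g (Set.Icc (-R) R)) : Integrable fun t => f t * g t := by
  have h : (fun t => f t * g t) = fun t => f t * (Set.Icc (-R) R).indicator g t := by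
    funext t
    by_cases h : f t = 0
    · simp [h]
    · rw [Set.indicator_of_mem (show t ∈ Set.Icc (-R) R from abs_le.1 (hf.support t h))]
  rw [h]
  exact (hg.integrable_indicator measurableSet_Icc).bdd_mul (c := M)
    hf.measurable.aestronglyMeasurable (Eventually.of_forall hf.bound)

theorem integrable (hf : IsBoundedDensity f M R) : Integrable f := by
  simpa using hf.integrable_mul (g := fun _ => 1) (integrableOn_const measure_Icc_lt_top.ne)

theorem integrable_ofReal (hf : IsBoundedDensity f M R) : Integrable fun t => (f t : ℂ) :=
  hf.integrable.ofReal

theorem ae_support (hf : IsBoundedDensity f M R) : ∀ᵐ t : ℝ, (f t : ℂ) ≠ 0 → |t| ≤ R :=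
  Eventually.of_forall fun t ht => hf.support t (by simpa using ht)

theorem integrableOn_log_sub (x a b : ℝ) :
    IntegrableOn (fun t => Real.log |t - x|) (Set.Icc a b) := by
  rcases le_total a b with hab | hab
  · rw [← intervalIntegrable_iff_integrableOn_Icc_of_le hab]
    simp_rw [Real.log_abs]
    simpa using (intervalIntegral.intervalIntegrable_log' (a := a - x) (b := b - x)).comp_sub_right x
  · refine IntegrableOn.mono_set (t := {a}) (integrableOn_singleton (by simp) (by simp)) ?_
    intro t ht
    exact le_antisymm (ht.2.trans hab) ht.1

theorem re_integral_log (hf : IsBoundedDensity f M R) {z : ℂ} (hz : 0 < z.im) :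
    (∫ t : ℝ, (f t : ℂ) * Complex.log ((t : ℂ) - z)).re
      = ∫ t : ℝ, f t * Real.log ‖(t : ℂ) - z‖ := by
  rw [← RCLike.re_eq_complex_re,
    ← integral_re (integrable_mul_log_sub hf.integrable_ofReal hf.ae_support hz)]
  simp [Complex.log_re]

/-- Dominated convergence: for `0 < y < 1`, `log |t - x| ≤ log |t - x - iy| ≤ log (|t - x| + 1) ≤ |t
- x|`. -/
theorem tendsto_re_integral_log (hf : IsBoundedDensity f M R) (x : ℝ) :
    Tendsto (fun y : ℝ => (∫ t : ℝ, (f t : ℂ) * Complex.log ((t : ℂ) - (x + y * Complex.I))).re)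
      (𝓝[>] 0) (𝓝 (∫ t, f t * Real.log |t - x|)) := by
  have h1 : Tendsto (fun y : ℝ => ∫ t : ℝ, f t * Real.log ‖(t : ℂ) - (x + y * Complex.I)‖)
      (𝓝[>] 0) (𝓝 (∫ t, f t * Real.log |t - x|)) := by
    refine tendsto_integral_filter_of_dominated_convergence
      (fun t => ‖f t * (abs (Real.log |t - x|) + |t - x|)‖) ?_ ?_ ?_ ?_
    · filter_upwards [self_mem_nhdsWithin] with y hy
      refine hf.measurable.aestronglyMeasurable.mul ?_
      exact (Real.measurable_log.comp (by fun_prop)).aestronglyMeasurable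
    · have hI : ∀ᶠ y : ℝ in 𝓝[>] 0, y ∈ Set.Ioo (0 : ℝ) 1 :=
        Ioo_mem_nhdsGT one_pos
      filter_upwards [hI] with y hy
      have hne : ∀ᵐ t : ℝ, t ≠ x := by simp [ae_iff]
      filter_upwards [hne] with t ht
      rw [norm_mul, norm_mul]
      refine mul_le_mul_of_nonneg_left ?_ (norm_nonneg _)
      have hpos : 0 < |t - x| := abs_pos.2 (sub_ne_zero.2 ht)
      have hre : (t : ℂ) - (x + y * Complex.I) = ((t - x : ℝ) : ℂ) - y * Complex.I := by
        push_cast; ring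
      have hl : |t - x| ≤ ‖(t : ℂ) - (x + y * Complex.I)‖ := by
        have := Complex.abs_re_le_norm ((t : ℂ) - (x + y * Complex.I))
        simpa using this
      have hu : ‖(t : ℂ) - (x + y * Complex.I)‖ ≤ |t - x| + 1 := by
        rw [hre]
        refine (norm_sub_le _ _).trans ?_
        rw [Complex.norm_real, Real.norm_eq_abs, norm_mul, Complex.norm_I, mul_one,
          Complex.norm_real, Real.norm_eq_abs, abs_of_pos hy.1]
        linarith [hy.2]
      have l1 := Real.log_le_log hpos hl
      have l2 := (Real.log_le_log (hpos.trans_le hl) hu)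
      have l3 := Real.log_le_sub_one_of_pos (show 0 < |t - x| + 1 by linarith)
      rw [Real.norm_eq_abs, Real.norm_eq_abs,
        abs_of_nonneg (show 0 ≤ abs (Real.log |t - x|) + |t - x| by positivity), abs_le]
      constructor
      · linarith [neg_abs_le (Real.log |t - x|)]
      · linarith [abs_nonneg (Real.log |t - x|)]
    · refine (hf.integrable_mul (Integrable.add ?_ ?_)).norm
      · exact (integrableOn_log_sub x _ _).abs
      · exact ContinuousOn.integrableOn_Icc (by fun_prop)
    · have hne : ∀ᵐ t : ℝ, t ≠ x := by simp [ae_iff]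
      filter_upwards [hne] with t ht
      refine Tendsto.const_mul _ ?_
      have h0 : Tendsto (fun y : ℝ => ‖(t : ℂ) - (x + y * Complex.I)‖) (𝓝[>] 0) (𝓝 |t - x|) := by
        have : Continuous fun y : ℝ => ‖(t : ℂ) - (x + y * Complex.I)‖ := by fun_prop
        have h := this.tendsto 0
        have e : ‖(t : ℂ) - (x + (0 : ℝ) * Complex.I)‖ = |t - x| := by
          rw [Complex.ofReal_zero, zero_mul, add_zero, ← Complex.ofReal_sub, Complex.norm_real,
            Real.norm_eq_abs]
        rw [e] at h
        exact h.mono_left nhdsWithin_le_nhds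
      exact (Real.continuousAt_log (abs_pos.2 (sub_ne_zero.2 ht)).ne').tendsto.comp h0
  refine h1.congr' ?_
  filter_upwards [self_mem_nhdsWithin] with y hy
  exact (hf.re_integral_log (by simpa using hy)).symm

/-- The Borel transform of a density. -/
noncomputable def cauchy (f : ℝ → ℝ) (z : ℂ) : ℂ := ∫ t : ℝ, (f t : ℂ) * ((t : ℂ) - z)⁻¹

theorem inv_sub_im (t x y : ℝ) :
    (((t : ℂ) - (x + y * Complex.I))⁻¹).im = y / ((t - x) ^ 2 + y ^ 2) := by
  rw [Complex.inv_im]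
  simp [Complex.normSq_apply]
  ring_nf

theorem inv_sub_re (t x y : ℝ) :
    (((t : ℂ) - (x + y * Complex.I))⁻¹).re = (t - x) / ((t - x) ^ 2 + y ^ 2) := by
  rw [Complex.inv_re]
  simp [Complex.normSq_apply]
  ring_nf

theorem cauchy_im (hf : IsBoundedDensity f M R) (x : ℝ) {y : ℝ} (hy : 0 < y) :
    (cauchy f (x + y * Complex.I)).im = ∫ t, f t * (y / ((t - x) ^ 2 + y ^ 2)) := by
  rw [cauchy, ← RCLike.im_eq_complex_im,
    ← integral_im (integrable_mul_inv_sub hf.integrable_ofReal (by simpa using hy))]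
  refine integral_congr_ae (Eventually.of_forall fun t => ?_)
  simp only [RCLike.im_eq_complex_im, Complex.im_ofReal_mul]
  rw [inv_sub_im]

theorem cauchy_re (hf : IsBoundedDensity f M R) (x : ℝ) {y : ℝ} (hy : 0 < y) :
    (cauchy f (x + y * Complex.I)).re = ∫ t, f t * ((t - x) / ((t - x) ^ 2 + y ^ 2)) := by
  rw [cauchy, ← RCLike.re_eq_complex_re,
    ← integral_re (integrable_mul_inv_sub hf.integrable_ofReal (by simpa using hy))]
  refine integral_congr_ae (Eventually.of_forall fun t => ?_)
  simp only [RCLike.re_eq_complex_re, Complex.re_ofReal_mul]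
  rw [inv_sub_re]

theorem integral_affine_mul (f κ : ℝ → ℝ) (x : ℝ) {h : ℝ} (hh : 0 < h) :
    ∫ τ, f (x + h * τ) * κ τ = ∫ t, f t * (h⁻¹ * κ ((t - x) / h)) := by
  have := integral_comp_affine (fun t => f t * κ ((t - x) / h)) x hh
  simp only [add_sub_cancel_left] at this
  simp_rw [mul_div_cancel_left₀ _ hh.ne'] at this
  rw [this, ← integral_const_mul]
  congr 1
  funext t
  ring

theorem poisson_eq (f : ℝ → ℝ) (x : ℝ) {y : ℝ} (hy : 0 < y) :
    ∫ t, f t * (y / ((t - x) ^ 2 + y ^ 2)) = ∫ τ, f (x + y * τ) * (1 + τ ^ 2)⁻¹ := by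
  rw [integral_affine_mul f _ x hy]
  congr 1
  funext t
  congr 1
  field_simp
  ring

/-- The Poisson kernel has total mass `π` at every height. -/
theorem abs_cauchy_im_le (hf : IsBoundedDensity f M R) {z : ℂ} (hz : 0 < z.im) :
    |(cauchy f z).im| ≤ M * Real.pi := by
  have h := hf.cauchy_im z.re hz
  rw [Complex.re_add_im, poisson_eq f _ hz] at h
  rw [h, ← integral_univ_inv_one_add_sq, ← integral_const_mul, ← Real.norm_eq_abs]
  refine norm_integral_le_of_norm_le (integrable_inv_one_add_sq.const_mul M)
    (Eventually.of_forall fun τ => ?_)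
  rw [norm_mul, Real.norm_eq_abs, Real.norm_of_nonneg (show 0 ≤ (1 + τ ^ 2)⁻¹ by positivity)]
  exact mul_le_mul_of_nonneg_right (hf.bound _) (by positivity)

theorem norm_cauchy_le {z : ℂ} (hf : IsBoundedDensity f M R)
    (h : ∀ t, |t| ≤ R → 1 ≤ ‖(t : ℂ) - z‖) : ‖cauchy f z‖ ≤ ∫ t, |f t| := by
  refine norm_integral_le_of_norm_le hf.integrable.abs (Eventually.of_forall fun t => ?_)
  rw [norm_mul, Complex.norm_real, Real.norm_eq_abs, norm_inv]
  by_cases h0 : f t = 0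
  · simp [h0]
  · exact mul_le_of_le_one_right (abs_nonneg _) (inv_le_one_of_one_le₀ (h t (hf.support t h0)))

theorem hasDerivAt_cauchy (hf : IsBoundedDensity f M R) {z : ℂ} (hz : 0 < z.im) :
    HasDerivAt (cauchy f) (∫ t : ℝ, (f t : ℂ) * (((t : ℂ) - z) ^ 2)⁻¹) z :=
  hasDerivAt_integral_inv_sub hf.integrable_ofReal hz

theorem continuous_cauchy (hf : IsBoundedDensity f M R) {y : ℝ} (hy : 0 < y) :
    Continuous fun x : ℝ => cauchy f (x + y * Complex.I) := by
  rw [continuous_iff_continuousAt]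
  intro x
  have h1 : ContinuousAt (cauchy f) ((x : ℂ) + y * Complex.I) :=
    (hf.hasDerivAt_cauchy (by simpa using hy)).continuousAt
  exact ContinuousAt.comp (f := fun x : ℝ => (x : ℂ) + y * Complex.I) h1
    (by fun_prop)

/-- Since `(Re C)² = Re C² + (Im C)²` and `Im C` is bounded by the Poisson estimate, only `∫ C²` is
at stake. Cauchy's theorem on a rectangle moves this integral to the height `1` and to the vertical
sides over `±A`. All of these keep distance at least `1` from the support, where `|C|` is at most
the `L¹` norm of `f`. The top contributes the factor `2A` and each side a factor `1`. The essential
point is uniformity in `y`. -/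
theorem integral_re_cauchy_sq_le (hf : IsBoundedDensity f M R) {A y : ℝ} (hA : R + 1 ≤ A)
    (hA0 : 0 ≤ A) (hy : 0 < y) (hy1 : y ≤ 1) :
    ∫ x in (-A)..A, (cauchy f (x + y * Complex.I)).re ^ 2
      ≤ 2 * A * (M * Real.pi) ^ 2 + (2 * A + 2) * (∫ t, |f t|) ^ 2 := by
  set B := ∫ t, |f t| with hB
  have hB0 : 0 ≤ B := integral_nonneg fun t => abs_nonneg _
  have hsq : ∀ z : ℂ, ‖cauchy f z‖ ≤ B → ‖cauchy f z ^ 2‖ ≤ B ^ 2 := fun z hz => by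
    rw [norm_pow]; gcongr
  have hrect := Complex.integral_boundary_rect_eq_zero_of_differentiableOn
    (fun z => cauchy f z ^ 2) (⟨-A, y⟩ : ℂ) (⟨A, 1⟩ : ℂ) (by
      intro z hz
      have hz' : 0 < z.im := by
        have h2 := hz.2
        simp only [Set.mem_preimage, Set.uIcc_of_le hy1, Set.mem_Icc] at h2
        linarith [h2.1]
      exact ((hf.hasDerivAt_cauchy hz').differentiableAt.pow 2).differentiableWithinAt)
  simp only [Complex.ofReal_neg, smul_eq_mul] at hrect
  have htop : ‖∫ x : ℝ in (-A)..A, cauchy f (x + (1 : ℝ) * Complex.I) ^ 2‖ ≤ B ^ 2 * |A - -A| := by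
    refine intervalIntegral.norm_integral_le_of_norm_le_const fun x _ => hsq _ ?_
    refine hf.norm_cauchy_le fun t _ => ?_
    have := im_le_norm_sub t (z := x + (1 : ℝ) * Complex.I) (by simp)
    simpa using this
  have hside : ∀ x : ℝ, R + 1 ≤ |x| →
      ‖∫ s : ℝ in y..1, cauchy f (x + s * Complex.I) ^ 2‖ ≤ B ^ 2 * |1 - y| := by
    intro x hx
    refine intervalIntegral.norm_integral_le_of_norm_le_const fun s _ => hsq _ ?_
    refine hf.norm_cauchy_le fun t ht => ?_
    have h1 := Complex.abs_re_le_norm ((t : ℂ) - (x + s * Complex.I))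
    simp only [Complex.sub_re, Complex.ofReal_re, Complex.add_re, Complex.mul_re, Complex.I_re,
      mul_zero, Complex.ofReal_im, Complex.I_im, mul_one, sub_self, add_zero] at h1
    have h2 := abs_sub_abs_le_abs_sub x t
    rw [abs_sub_comm] at h2
    linarith
  have hR := hside A (by rwa [abs_of_nonneg hA0])
  have hL := hside (-A) (by rwa [abs_neg, abs_of_nonneg hA0])
  have habs : |A - -A| = 2 * A := by rw [abs_of_nonneg (by linarith)]; ring
  have habs1 : |1 - y| ≤ 1 := by rw [abs_of_nonneg (by linarith)]; linarith
  rw [habs] at htop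
  have hbot : ‖∫ x : ℝ in (-A)..A, cauchy f (x + y * Complex.I) ^ 2‖ ≤ (2 * A + 2) * B ^ 2 := by
    have e : ∫ x : ℝ in (-A)..A, cauchy f (x + y * Complex.I) ^ 2
        = (∫ x : ℝ in (-A)..A, cauchy f (x + (1 : ℝ) * Complex.I) ^ 2)
          - Complex.I * (∫ s : ℝ in y..1, cauchy f (A + s * Complex.I) ^ 2)
          + Complex.I * ∫ s : ℝ in y..1, cauchy f ((-A : ℝ) + s * Complex.I) ^ 2 := by
      push_cast at hrect ⊢
      linear_combination hrect
    rw [e]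
    refine (norm_add_le _ _).trans ((add_le_add_left (norm_sub_le _ _) _).trans ?_)
    rw [norm_mul, norm_mul, Complex.norm_I, one_mul, one_mul]
    have : B ^ 2 * |1 - y| ≤ B ^ 2 := mul_le_of_le_one_right (by positivity) habs1
    linarith
  have hc := hf.continuous_cauchy hy
  have i1 : IntervalIntegrable (fun x : ℝ => cauchy f (x + y * Complex.I) ^ 2) volume (-A) A :=
    (hc.pow 2).intervalIntegrable _ _
  have i2 : IntervalIntegrable (fun x : ℝ => (cauchy f (x + y * Complex.I)).im ^ 2)
      volume (-A) A := ((Complex.continuous_im.comp hc).pow 2).intervalIntegrable _ _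
  have hre : ∫ x in (-A)..A, (cauchy f (x + y * Complex.I)).re ^ 2
      = (∫ x : ℝ in (-A)..A, cauchy f (x + y * Complex.I) ^ 2).re
        + ∫ x in (-A)..A, (cauchy f (x + y * Complex.I)).im ^ 2 := by
    have := intervalIntegral.intervalIntegral_re i1
    simp only [RCLike.re_eq_complex_re] at this
    rw [← this, ← intervalIntegral.integral_add _ i2]
    · congr 1
      funext x
      rw [sq, sq, sq, Complex.mul_re]
      ring
    · exact (Complex.continuous_re.comp (hc.pow 2)).intervalIntegrable _ _
  have him : ∫ x in (-A)..A, (cauchy f (x + y * Complex.I)).im ^ 2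
      ≤ 2 * A * (M * Real.pi) ^ 2 := by
    have : ∫ x in (-A)..A, (cauchy f (x + y * Complex.I)).im ^ 2
        ≤ ∫ x in (-A)..A, (M * Real.pi) ^ 2 := by
      refine intervalIntegral.integral_mono (by linarith) i2 (by simp) fun x => ?_
      exact sq_le_sq.2 ((hf.abs_cauchy_im_le (by simpa using hy)).trans (le_abs_self _))
    rw [intervalIntegral.integral_const, smul_eq_mul] at this
    linarith
  rw [hre]
  have := (Complex.re_le_norm (∫ x : ℝ in (-A)..A, cauchy f (x + y * Complex.I) ^ 2)).trans hbot
  linarith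

theorem integral_abs_re_cauchy_le (hf : IsBoundedDensity f M R) {A y : ℝ} (hA : R + 1 ≤ A)
    (hA0 : 0 ≤ A) (hy : 0 < y) (hy1 : y ≤ 1) :
    ∫ x in (-A)..A, |(cauchy f (x + y * Complex.I)).re|
      ≤ 2 * A + (2 * A * (M * Real.pi) ^ 2 + (2 * A + 2) * (∫ t, |f t|) ^ 2) := by
  have hc := Complex.continuous_re.comp (hf.continuous_cauchy hy)
  have h1 : ∫ x in (-A)..A, |(cauchy f (x + y * Complex.I)).re|
      ≤ ∫ x in (-A)..A, (1 + (cauchy f (x + y * Complex.I)).re ^ 2) := by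
    refine intervalIntegral.integral_mono (by linarith) (hc.abs.intervalIntegrable _ _)
      ((continuous_const.add (hc.pow 2)).intervalIntegrable _ _) fun x => ?_
    have := sq_nonneg (|(cauchy f (x + y * Complex.I)).re| - 1)
    simp only
    nlinarith [sq_abs (cauchy f (x + y * Complex.I)).re, abs_nonneg (cauchy f (x + y * Complex.I)).re]
  have i2 : IntervalIntegrable (fun x : ℝ => (cauchy f (x + y * Complex.I)).re ^ 2)
      volume (-A) A := (hc.pow 2).intervalIntegrable _ _
  rw [intervalIntegral.integral_add (by simp) i2,
    intervalIntegral.integral_const, smul_eq_mul] at h1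
  have := hf.integral_re_cauchy_sq_le hA hA0 hy hy1
  linarith

theorem hasDerivAt_re_integral_log (hf : IsBoundedDensity f M R) (x : ℝ) {y : ℝ} (hy : 0 < y) :
    HasDerivAt (fun x : ℝ => (∫ t : ℝ, (f t : ℂ) * Complex.log ((t : ℂ) - (x + y * Complex.I))).re)
      (-(cauchy f (x + y * Complex.I)).re) x := by
  have h := hasDerivAt_integral_log_sub hf.integrable_ofReal hf.ae_support
    (z := x + y * Complex.I) (by simpa using hy)
  have h2 : HasDerivAt (fun x : ℝ => (x : ℂ) + y * Complex.I) 1 x :=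
    (Complex.ofRealCLM.hasDerivAt (x := x)).add_const _
  have h3 := Complex.reCLM.hasFDerivAt.comp_hasDerivAt x (HasDerivAt.comp x h h2)
  simpa [cauchy, Function.comp_def] using h3

/-- The logarithmic potential of a density. -/
noncomputable def logPotential (f : ℝ → ℝ) (x : ℝ) : ℝ := ∫ t, f t * Real.log |t - x|

theorem sum_abs_sub_le (hf : IsBoundedDensity f M R) {A y : ℝ} (hy : 0 < y)
    {u : ℕ → ℝ} (hu : Monotone u) (huA : ∀ i, u i ∈ Set.Icc (-A) A) (n : ℕ) :
    ∑ i ∈ Finset.range n,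
        |(∫ t : ℝ, (f t : ℂ) * Complex.log ((t : ℂ) - (u (i + 1) + y * Complex.I))).re
          - (∫ t : ℝ, (f t : ℂ) * Complex.log ((t : ℂ) - (u i + y * Complex.I))).re|
      ≤ ∫ x in (-A)..A, |(cauchy f (x + y * Complex.I)).re| := by
  have hc := Complex.continuous_re.comp (hf.continuous_cauchy hy)
  have hint : ∀ a b : ℝ, IntervalIntegrable (fun x : ℝ => |(cauchy f (x + y * Complex.I)).re|)
      volume a b := fun a b => hc.abs.intervalIntegrable _ _
  calc _ ≤ ∑ i ∈ Finset.range n,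
        ∫ x in (u i)..(u (i + 1)), |(cauchy f (x + y * Complex.I)).re| := by
        refine Finset.sum_le_sum fun i _ => ?_
        have hi : IntervalIntegrable (fun x : ℝ => -(cauchy f (x + y * Complex.I)).re)
            volume (u i) (u (i + 1)) := hc.neg.intervalIntegrable _ _
        rw [← intervalIntegral.integral_eq_sub_of_hasDerivAt
          (fun x _ => hf.hasDerivAt_re_integral_log x hy) hi, ← Real.norm_eq_abs]
        refine (intervalIntegral.norm_integral_le_integral_norm (hu i.le_succ)).trans_eq ?_
        simp
    _ = ∫ x in (u 0)..(u n), |(cauchy f (x + y * Complex.I)).re| :=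
        intervalIntegral.sum_integral_adjacent_intervals fun _ _ => hint _ _
    _ ≤ _ := by
        refine intervalIntegral.integral_mono_interval (huA 0).1 (hu (Nat.zero_le n)) (huA n).2
          (Eventually.of_forall fun x => abs_nonneg _) (hint _ _)

/-- At height `y` the variation is at most the integral of `|Re C|`, which is bounded uniformly in
`0 < y < 1`. For a fixed partition the bound survives the limit `y → 0`. -/
theorem boundedVariationOn_logPotential (hf : IsBoundedDensity f M R) {A : ℝ} (hA : R + 1 ≤ A)
    (hA0 : 0 ≤ A) : BoundedVariationOn (logPotential f) (Set.Icc (-A) A) := by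
  set C := 2 * A + (2 * A * (M * Real.pi) ^ 2 + (2 * A + 2) * (∫ t, |f t|) ^ 2)
  refine ne_top_of_le_ne_top (b := ENNReal.ofReal C) ENNReal.ofReal_ne_top ?_
  refine iSup_le fun ⟨n, u, hu, huA⟩ => ?_
  simp only [edist_dist, Real.dist_eq]
  rw [← ENNReal.ofReal_sum_of_nonneg fun _ _ => abs_nonneg _]
  refine ENNReal.ofReal_le_ofReal ?_
  have hlim : Tendsto (fun y : ℝ => ∑ i ∈ Finset.range n,
        |(∫ t : ℝ, (f t : ℂ) * Complex.log ((t : ℂ) - (u (i + 1) + y * Complex.I))).re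
          - (∫ t : ℝ, (f t : ℂ) * Complex.log ((t : ℂ) - (u i + y * Complex.I))).re|) (𝓝[>] 0)
      (𝓝 (∑ i ∈ Finset.range n, |logPotential f (u (i + 1)) - logPotential f (u i)|)) :=
    tendsto_finsetSum _ fun i _ =>
      ((hf.tendsto_re_integral_log _).sub (hf.tendsto_re_integral_log _)).abs
  refine le_of_tendsto hlim ?_
  filter_upwards [Ioo_mem_nhdsGT (one_pos (α := ℝ))] with y hy
  exact (hf.sum_abs_sub_le hy.1 hu huA n).trans
    (hf.integral_abs_re_cauchy_le hA hA0 hy.1 hy.2.le)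

theorem ae_differentiableAt_logPotential (hf : IsBoundedDensity f M R) :
    ∀ᵐ x, DifferentiableAt ℝ (logPotential f) x := by
  have h : ∀ n : ℕ, ∀ᵐ x, x ∈ Set.uIcc (-(|R| + 1 + n)) (|R| + 1 + n) →
      DifferentiableAt ℝ (logPotential f) x := fun n => by
    have hn : 0 ≤ |R| + 1 + n := by positivity
    refine BoundedVariationOn.ae_differentiableAt_of_mem_uIcc ?_
    rw [Set.uIcc_of_le (by linarith)]
    refine hf.boundedVariationOn_logPotential ?_ hn
    linarith [le_abs_self R, (Nat.cast_nonneg n : (0 : ℝ) ≤ n)]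
  filter_upwards [ae_all_iff.2 h] with x hx
  obtain ⟨n, hn⟩ := exists_nat_ge |x|
  refine hx n ?_
  rw [Set.uIcc_of_le (by linarith [abs_nonneg R, (Nat.cast_nonneg n : (0 : ℝ) ≤ n)]), Set.mem_Icc,
    ← abs_le]
  linarith [abs_nonneg R]

end IsBoundedDensity

/-! ### Symmetric difference quotients and the conjugate Poisson integral -/

/-- The kernel that relates symmetric difference quotients of the logarithmic potential to the
conjugate Poisson integral. -/
noncomputable def logKernel (τ : ℝ) : ℝ :=
  (Real.log |τ - 1| - Real.log |τ + 1|) / 2 + τ / (τ ^ 2 + 1)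

theorem logKernel_neg (τ : ℝ) : logKernel (-τ) = -logKernel τ := by
  have h1 : |-τ - 1| = |τ + 1| := by rw [← abs_neg]; ring_nf
  have h2 : |-τ + 1| = |τ - 1| := by rw [← abs_neg]; ring_nf
  rw [logKernel, logKernel, h1, h2]
  ring

theorem integral_logKernel : ∫ τ, logKernel τ = 0 := by
  have h := integral_neg_eq_self logKernel volume
  simp_rw [logKernel_neg] at h
  rw [integral_neg] at h
  linarith

theorem abs_logKernel_le_of_two_le {τ : ℝ} (h : 2 ≤ τ) : |logKernel τ| ≤ 3 * (1 + τ ^ 2)⁻¹ := by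
  have hp : 0 < τ - 1 := by linarith
  have hq : 0 < τ + 1 := by linarith
  rw [logKernel, abs_of_pos hp, abs_of_pos hq]
  -- Half the logarithmic difference lies between `-1/(τ - 1)` and `-1/(τ + 1)`. Both endpoints
  -- differ from `-τ/(τ² + 1)` by at most `3/(1 + τ²)`; the constant is the value of `(τ + 1)/(τ -
  -- 1)` at `τ = 2`.
  have e1 : Real.log (τ + 1) - Real.log (τ - 1) ≤ 2 / (τ - 1) := by
    rw [← Real.log_div hq.ne' hp.ne']
    refine (Real.log_le_sub_one_of_pos (by positivity)).trans_eq ?_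
    field_simp
    ring
  have e2 : Real.log (τ - 1) - Real.log (τ + 1) ≤ -(2 / (τ + 1)) := by
    rw [← Real.log_div hp.ne' hq.ne']
    refine (Real.log_le_sub_one_of_pos (by positivity)).trans_eq ?_
    field_simp
    ring
  have e3 : 1 / (τ - 1) - τ / (τ ^ 2 + 1) ≤ 3 * (1 + τ ^ 2)⁻¹ := by
    have : 1 / (τ - 1) - τ / (τ ^ 2 + 1) = ((τ + 1) / (τ - 1)) * (1 + τ ^ 2)⁻¹ := by
      field_simp
      ring
    rw [this]
    refine mul_le_mul_of_nonneg_right ?_ (by positivity)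
    rw [div_le_iff₀ hp]
    linarith
  have e4 : τ / (τ ^ 2 + 1) - 1 / (τ + 1) ≤ 3 * (1 + τ ^ 2)⁻¹ := by
    have : τ / (τ ^ 2 + 1) - 1 / (τ + 1) = ((τ - 1) / (τ + 1)) * (1 + τ ^ 2)⁻¹ := by
      field_simp
      ring
    rw [this]
    refine mul_le_mul_of_nonneg_right ?_ (by positivity)
    rw [div_le_iff₀ hq]
    linarith
  have f1 : 2 / (τ - 1) = 2 * (1 / (τ - 1)) := by ring
  have f2 : 2 / (τ + 1) = 2 * (1 / (τ + 1)) := by ring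
  rw [abs_le]
  constructor <;> linarith

theorem abs_logKernel_le {τ : ℝ} (h : 2 ≤ |τ|) : |logKernel τ| ≤ 3 * (1 + τ ^ 2)⁻¹ := by
  rcases le_abs.1 h with h | h
  · exact abs_logKernel_le_of_two_le h
  · simpa [logKernel_neg] using abs_logKernel_le_of_two_le h

theorem measurable_logKernel : Measurable logKernel := by
  unfold logKernel
  refine Measurable.add ?_ ?_
  · exact ((Real.measurable_log.comp (by fun_prop)).sub
      (Real.measurable_log.comp (by fun_prop))).div_const 2
  · exact measurable_id.div (by fun_prop)

theorem integrable_logKernel : Integrable logKernel := by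
  rw [← integrableOn_univ, ← Set.union_compl_self (Set.Icc (-2 : ℝ) 2)]
  refine IntegrableOn.union ?_ ?_
  · have h1 := IsBoundedDensity.integrableOn_log_sub 1 (-2) 2
    have h2 := IsBoundedDensity.integrableOn_log_sub (-1) (-2) 2
    simp only [sub_neg_eq_add] at h2
    have h3 : IntegrableOn (fun τ : ℝ => τ / (τ ^ 2 + 1)) (Set.Icc (-2) 2) := by
      refine ContinuousOn.integrableOn_Icc (Continuous.continuousOn ?_)
      exact continuous_id.div (by fun_prop) fun τ => by positivity
    exact ((h1.sub h2).div_const 2).add h3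
  · refine Integrable.mono' (integrable_inv_one_add_sq.const_mul 3).integrableOn
      measurable_logKernel.aestronglyMeasurable ?_
    filter_upwards [ae_restrict_mem measurableSet_Icc.compl] with τ hτ
    refine abs_logKernel_le ?_
    by_contra hc
    exact hτ (abs_le.1 (not_le.1 hc).le)

namespace IsBoundedDensity

variable {f : ℝ → ℝ} {M R : ℝ}

/-- The step of the difference quotient equals the height of the Cauchy transform, so both scale as
`t = x + hτ`. The terms `log h` produced by the scaling cancel in the symmetric difference. -/
theorem logPotential_symm_quotient (hf : IsBoundedDensity f M R) (x : ℝ) {h : ℝ} (hh : 0 < h) :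
    (logPotential f (x + h) - logPotential f (x - h)) / (2 * h)
        + (cauchy f (x + h * Complex.I)).re = ∫ τ, f (x + h * τ) * logKernel τ := by
  have i1 := fun s => hf.integrable_mul (integrableOn_log_sub s (-R) R)
  have i2 : Integrable fun t => f t * ((t - x) / ((t - x) ^ 2 + h ^ 2)) := by
    refine hf.integrable_mul (ContinuousOn.integrableOn_Icc (Continuous.continuousOn ?_))
    exact (by fun_prop : Continuous fun t : ℝ => t - x).div (by fun_prop) fun t => by positivity
  have i3 : Integrable fun t =>
      (f t * Real.log |t - (x + h)| - f t * Real.log |t - (x - h)|) / (2 * h) :=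
    ((i1 _).sub (i1 _)).div_const _
  rw [hf.cauchy_re x hh, integral_affine_mul f _ x hh, logPotential, logPotential,
    ← integral_sub (i1 _) (i1 _), ← integral_div, ← integral_add i3 i2]
  have hne1 : ∀ᵐ t : ℝ, t ≠ x + h := by simp [ae_iff]
  have hne2 : ∀ᵐ t : ℝ, t ≠ x - h := by simp [ae_iff]
  refine integral_congr_ae ?_
  filter_upwards [hne1, hne2] with t h1 h2
  have e1 : |t - (x + h)| = h * |(t - x) / h - 1| := by
    rw [← abs_of_pos hh, ← abs_mul, abs_of_pos hh]
    congr 1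
    field_simp
    ring
  have e2 : |t - (x - h)| = h * |(t - x) / h + 1| := by
    rw [← abs_of_pos hh, ← abs_mul, abs_of_pos hh]
    congr 1
    field_simp
    ring
  have n1 : |(t - x) / h - 1| ≠ 0 := fun h0 => by
    rw [h0, mul_zero, abs_eq_zero, sub_eq_zero] at e1
    exact h1 e1
  have n2 : |(t - x) / h + 1| ≠ 0 := fun h0 => by
    rw [h0, mul_zero, abs_eq_zero, sub_eq_zero] at e2
    exact h2 e2
  rw [e1, e2, Real.log_mul hh.ne' n1, Real.log_mul hh.ne' n2, logKernel]
  field_simp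
  ring

theorem tendsto_cauchy_im (hf : IsBoundedDensity f M R) {x : ℝ} (hx : IsLebesguePoint f x) :
    Tendsto (fun y : ℝ => (cauchy f (x + y * Complex.I)).im) (𝓝[>] 0) (𝓝 (f x * Real.pi)) := by
  have h := hx.tendsto_integral_mul hf.measurable hf.bound integrable_inv_one_add_sq
  rw [integral_univ_inv_one_add_sq] at h
  refine h.congr' ?_
  filter_upwards [self_mem_nhdsWithin] with y hy
  rw [hf.cauchy_im x hy, poisson_eq f x hy]

/-- The kernel is odd, so its integral vanishes and the symmetric quotient plus `Re C` tends to `0`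
at a Lebesgue point. The symmetric quotient is the mean of the two one-sided quotients and tends to
`d`. -/
theorem tendsto_cauchy_re (hf : IsBoundedDensity f M R) {x d : ℝ} (hx : IsLebesguePoint f x)
    (hd : HasDerivAt (logPotential f) d x) :
    Tendsto (fun y : ℝ => (cauchy f (x + y * Complex.I)).re) (𝓝[>] 0) (𝓝 (-d)) := by
  have h1 := hx.tendsto_integral_mul hf.measurable hf.bound integrable_logKernel
  rw [integral_logKernel, mul_zero] at h1
  have hs := hasDerivAt_iff_tendsto_slope_zero.1 hd
  have hp : Tendsto (fun h : ℝ => h⁻¹ • (logPotential f (x + h) - logPotential f x)) (𝓝[>] 0)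
      (𝓝 d) := hs.mono_left (nhdsWithin_mono _ fun h hh => ne_of_gt hh)
  have hneg : Tendsto (fun h : ℝ => -h) (𝓝[>] 0) (𝓝[≠] 0) := by
    refine tendsto_nhdsWithin_iff.2 ⟨?_, ?_⟩
    · have := (continuous_neg (G := ℝ)).tendsto 0
      rw [neg_zero] at this
      exact this.mono_left nhdsWithin_le_nhds
    · filter_upwards [self_mem_nhdsWithin] with h hh
      simpa using (ne_of_gt hh)
  have hm := hs.comp hneg
  have h2 := (h1.sub ((hp.add hm).div_const 2))
  have e : (0 : ℝ) - (d + d) / 2 = -d := by ring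
  rw [e] at h2
  refine h2.congr' ?_
  filter_upwards [self_mem_nhdsWithin] with h hh
  have hh : 0 < h := hh
  rw [← hf.logPotential_symm_quotient x hh]
  simp only [Function.comp, smul_eq_mul]
  rw [← sub_eq_add_neg, inv_neg]
  field_simp
  ring

/-- Almost everywhere, the logarithmic potential of a bounded density is differentiable, and its
derivative is determined by the boundary value of the Borel transform. -/
theorem ae_tendsto_cauchy (hf : IsBoundedDensity f M R) :
    ∀ᵐ x : ℝ, ∃ g : ℂ, Tendsto (fun y : ℝ => cauchy f (x + y * Complex.I)) (𝓝[>] 0) (𝓝 g) ∧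
      HasDerivAt (logPotential f) (-g.re) x := by
  filter_upwards [ae_isLebesguePoint hf.integrable.locallyIntegrable,
    hf.ae_differentiableAt_logPotential] with x hx hd
  refine ⟨⟨-deriv (logPotential f) x, f x * Real.pi⟩, ?_, by simpa using hd.hasDerivAt⟩
  have h1 := hf.tendsto_cauchy_re hx hd.hasDerivAt
  have h2 := hf.tendsto_cauchy_im hx
  have := ((Complex.continuous_ofReal.tendsto _).comp h1).add
    (((Complex.continuous_ofReal.tendsto _).comp h2).mul_const Complex.I)
  rw [← Complex.mk_eq_add_mul_I] at this
  refine this.congr fun y => ?_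
  exact Complex.re_add_im _

end IsBoundedDensity

/-! ### Density points and approximate derivatives -/

/-- `x` is a point of density of `F`. -/
def IsDensityPoint (F : Set ℝ) (x : ℝ) : Prop :=
  Tendsto (fun r : ℝ => volume.real (Fᶜ ∩ Metric.closedBall x r) / r) (𝓝[>] 0) (𝓝 0)

theorem ae_isDensityPoint {F : Set ℝ} (hF : MeasurableSet F) :
    ∀ᵐ x, x ∈ F → IsDensityPoint F x := by
  rw [← ae_restrict_iff' hF]
  filter_upwards [IsUnifLocDoublingMeasure.ae_tendsto_measure_inter_div volume F 1] with x hx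
  have h := hx (l := 𝓝[>] (0 : ℝ)) (fun _ => x) (fun r => r) tendsto_id (by
    filter_upwards [self_mem_nhdsWithin] with r hr
    simpa using (le_of_lt hr : (0 : ℝ) ≤ r))
  have h2 := ((ENNReal.continuousAt_toReal ENNReal.one_ne_top).tendsto.comp h).const_sub 1
    |>.const_mul 2
  rw [ENNReal.toReal_one, sub_self, mul_zero] at h2
  refine h2.congr' ?_
  filter_upwards [self_mem_nhdsWithin] with r hr
  have hr : 0 < r := hr
  have hfin : volume (Metric.closedBall x r) ≠ ⊤ := measure_closedBall_lt_top.ne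
  have h3 := measureReal_inter_add_sdiff (μ := volume) (s := Metric.closedBall x r) hF hfin
  have h4 : volume.real (Metric.closedBall x r) = 2 * r := by
    rw [measureReal_def, Real.volume_closedBall, ENNReal.toReal_ofReal (by positivity)]
  have h5 : Fᶜ ∩ Metric.closedBall x r = Metric.closedBall x r \ F := by
    rw [Set.inter_comm, Set.sdiff_eq]
  simp only [Function.comp, ENNReal.toReal_div]
  rw [← measureReal_def, ← measureReal_def, h4, h5, Set.inter_comm]
  rw [h4] at h3
  field_simp
  linarith

theorem HasDerivWithinAt.hasApproxDerivAt {φ : ℝ → ℝ} {d x : ℝ} {F : Set ℝ}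
    (h : HasDerivWithinAt φ d F x) (hx : IsDensityPoint F x) : HasApproxDerivAt φ d x := by
  intro ε hε
  rw [hasDerivWithinAt_iff_tendsto_slope, Metric.tendsto_nhdsWithin_nhds] at h
  obtain ⟨δ, hδ, hs⟩ := h ε hε
  have hlim := Tendsto.const_mul (1 / 2 : ℝ) hx
  rw [mul_zero] at hlim
  refine squeeze_zero' ?_ ?_ hlim
  · filter_upwards [self_mem_nhdsWithin] with r hr
    have hr : 0 < r := hr
    positivity
  filter_upwards [Ioo_mem_nhdsGT hδ] with r hr
  have hr0 : 0 < r := hr.1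
  -- For `x + y` in `F` the quotient is within `ε` of `d`, so exceptional shifts lead out of `F`.
  -- The shift `0` must be allowed separately, since there the quotient takes the default value of
  -- division by zero.
  have hsub : {y : ℝ | y ∈ Set.Ioo (-r) r ∧ ε ≤ |(φ (x + y) - φ x) / y - d|}
      ⊆ {0} ∪ (fun y => x + y) ⁻¹' (Fᶜ ∩ Metric.closedBall x r) := by
    rintro y ⟨hy, hye⟩
    have hyr : |y| < r := abs_lt.2 hy
    by_cases hy0 : y = 0
    · exact Or.inl hy0
    refine Or.inr ⟨fun hF => ?_, by simpa using hyr.le⟩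
    have := hs (x := x + y) ⟨hF, by simpa using hy0⟩ (by simpa using hyr.trans hr.2)
    rw [Real.dist_eq, slope_def_field, add_sub_cancel_left] at this
    exact absurd hye (not_le.2 this)
  have hvol : volume ((fun y => x + y) ⁻¹' (Fᶜ ∩ Metric.closedBall x r))
      = volume (Fᶜ ∩ Metric.closedBall x r) := measure_preimage_add _ _ _
  have hfin : volume (Fᶜ ∩ Metric.closedBall x r) ≠ ⊤ :=
    measure_ne_top_of_subset Set.inter_subset_right measure_closedBall_lt_top.ne
  have hm : volume.real {y : ℝ | y ∈ Set.Ioo (-r) r ∧ ε ≤ |(φ (x + y) - φ x) / y - d|}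
      ≤ volume.real (Fᶜ ∩ Metric.closedBall x r) := by
    refine ENNReal.toReal_mono hfin ((measure_mono hsub).trans ((measure_union_le _ _).trans ?_))
    rw [hvol]
    simp
  calc 1 / (2 * r) * volume.real {y : ℝ | y ∈ Set.Ioo (-r) r ∧ ε ≤ |(φ (x + y) - φ x) / y - d|}
      ≤ 1 / (2 * r) * volume.real (Fᶜ ∩ Metric.closedBall x r) := by gcongr
    _ = 1 / 2 * (volume.real (Fᶜ ∩ Metric.closedBall x r) / r) := by field_simp

/-! ### Cauchy integrals of densities vanishing on a closed set -/

/-- A density `u` that is controlled by the distance to the closed set `F`. -/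
structure IsControlledBy (u : ℝ → ℝ) (F : Set ℝ) (L M R : ℝ) : Prop
    extends IsBoundedDensity u M R where
  isClosed : IsClosed F
  nonempty : F.Nonempty
  le_infDist : ∀ s, |u s| ≤ L * Metric.infDist s F
  const_nonneg : 0 ≤ L

namespace IsControlledBy

variable {u : ℝ → ℝ} {F : Set ℝ} {L M R : ℝ}

theorem le_abs_sub (hu : IsControlledBy u F L M R) {x : ℝ} (hx : x ∈ F) (s : ℝ) :
    |u s| ≤ L * |s - x| := by
  refine (hu.le_infDist s).trans (mul_le_mul_of_nonneg_left ?_ hu.const_nonneg)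
  exact Metric.infDist_le_dist_of_mem hx

theorem eq_zero (hu : IsControlledBy u F L M R) {x : ℝ} (hx : x ∈ F) : u x = 0 := by
  have := hu.le_abs_sub hx x
  simpa using this

/-- With `d` the distance from `s` to `F`, every `x` in `F` has `|s - x| ≥ d`, so `d/(s - x)²` is at
most twice the Poisson kernel `d/((s - x)² + d²)`. The resulting bound does not depend on `s`. -/
theorem lintegral_inv_sq_le (hu : IsControlledBy u F L M R) (s : ℝ) :
    ∫⁻ x in F, ENNReal.ofReal (|u s| / (s - x) ^ 2) ≤ ENNReal.ofReal (2 * L * Real.pi) := by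
  by_cases h0 : u s = 0
  · simp [h0]
  have hs : s ∉ F := fun h => h0 (hu.eq_zero h)
  set d := Metric.infDist s F with hd
  have hdpos : 0 < d := (hu.isClosed.notMem_iff_infDist_pos hu.nonempty).1 hs
  have hint : Integrable fun x : ℝ => 2 * L * (d / ((x - s) ^ 2 + d ^ 2)) := by
    refine Integrable.const_mul ?_ _
    have h1 := (integrable_inv_one_add_sq.comp_div hdpos.ne').comp_sub_right s
    refine (h1.const_mul d⁻¹).congr (Eventually.of_forall fun x => ?_)
    simp only
    field_simp
    ring
  have hval : ∫ x : ℝ, 2 * L * (d / ((x - s) ^ 2 + d ^ 2)) = 2 * L * Real.pi := by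
    rw [integral_const_mul]
    have := IsBoundedDensity.poisson_eq (fun _ => 1) s hdpos
    simp only [one_mul, integral_univ_inv_one_add_sq] at this
    rw [this]
  rw [← hval, ofReal_integral_eq_lintegral_ofReal hint (Eventually.of_forall fun x => by
    have := hu.const_nonneg
    simp only [Pi.zero_apply]
    positivity)]
  refine le_trans (lintegral_mono_ae ?_) (setLIntegral_le_lintegral F _)
  filter_upwards [ae_restrict_mem hu.isClosed.measurableSet] with x hx
  refine ENNReal.ofReal_le_ofReal ?_
  have h1 : d ≤ |s - x| := Metric.infDist_le_dist_of_mem hx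
  have h2 : d ^ 2 ≤ (s - x) ^ 2 := by
    rw [← sq_abs (s - x)]
    gcongr
  have h3 : (0 : ℝ) < (s - x) ^ 2 := lt_of_lt_of_le (by positivity) h2
  have h4 : (x - s) ^ 2 = (s - x) ^ 2 := by ring
  rw [h4]
  calc |u s| / (s - x) ^ 2 ≤ L * d / (s - x) ^ 2 := by
        gcongr
        exact hu.le_infDist s
    _ ≤ 2 * L * (d / ((s - x) ^ 2 + d ^ 2)) := by
        rw [mul_div_assoc', div_le_div_iff₀ h3 (by positivity)]
        have : 0 ≤ L * d := mul_nonneg hu.const_nonneg hdpos.le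
        nlinarith

/-- Finiteness of the Marcinkiewicz integral. -/
theorem ae_integrable_inv_sq (hu : IsControlledBy u F L M R) :
    ∀ᵐ x, x ∈ F → Integrable fun s => u s / (s - x) ^ 2 := by
  have hmeas : Measurable fun p : ℝ × ℝ => ENNReal.ofReal (|u p.2| / (p.2 - p.1) ^ 2) := by
    refine ENNReal.measurable_ofReal.comp (Measurable.div ?_ (by fun_prop))
    exact (hu.measurable.comp measurable_snd).norm
  have hfin : ∫⁻ x in F, ∫⁻ s, ENNReal.ofReal (|u s| / (s - x) ^ 2) < ⊤ := by
    -- Tonelli: integrating first over `x` in `F` gives a bounded function of `s` supported in `[-R,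
    -- R]`.
    rw [lintegral_lintegral_swap hmeas.aemeasurable]
    calc ∫⁻ s, ∫⁻ x in F, ENNReal.ofReal (|u s| / (s - x) ^ 2)
        ≤ ∫⁻ s, (Set.Icc (-R) R).indicator (fun _ => ENNReal.ofReal (2 * L * Real.pi)) s := by
          refine lintegral_mono fun s => ?_
          by_cases h0 : u s = 0
          · simp [h0]
          · rw [Set.indicator_of_mem (show s ∈ Set.Icc (-R) R from abs_le.1 (hu.support s h0))]
            exact hu.lintegral_inv_sq_le s
      _ = ENNReal.ofReal (2 * L * Real.pi) * volume (Set.Icc (-R) R) := by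
          rw [lintegral_indicator measurableSet_Icc, setLIntegral_const]
      _ < ⊤ := ENNReal.mul_lt_top ENNReal.ofReal_lt_top measure_Icc_lt_top
  rw [← ae_restrict_iff' hu.isClosed.measurableSet]
  filter_upwards [ae_lt_top hmeas.lintegral_prod_right' hfin.ne] with x hx
  refine ⟨(hu.measurable.div (by fun_prop)).aestronglyMeasurable, ?_⟩
  rw [hasFiniteIntegral_iff_norm]
  convert hx using 3 with s
  congr 1
  rw [norm_div, Real.norm_eq_abs, Real.norm_of_nonneg (sq_nonneg _)]

theorem tendsto_sub_vertical (s x : ℝ) :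
    Tendsto (fun y : ℝ => (s : ℂ) - (x + y * Complex.I)) (𝓝[>] 0) (𝓝 ((s - x : ℝ) : ℂ)) := by
  have : Continuous fun y : ℝ => (s : ℂ) - (x + y * Complex.I) := by fun_prop
  have h := this.tendsto 0
  simp only [Complex.ofReal_zero, zero_mul, add_zero] at h
  rw [Complex.ofReal_sub]
  exact h.mono_left nhdsWithin_le_nhds

theorem abs_sub_le_norm_sub (s x y : ℝ) : |s - x| ≤ ‖(s : ℂ) - (x + y * Complex.I)‖ := by
  have := Complex.abs_re_le_norm ((s : ℂ) - (x + y * Complex.I))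
  simpa using this

theorem tendsto_integral_inv_sq (hu : IsControlledBy u F L M R) {x : ℝ} (hxF : x ∈ F)
    (hx : Integrable fun s => u s / (s - x) ^ 2) :
    Tendsto (fun y : ℝ => ∫ s : ℝ, (u s : ℂ) * (((s : ℂ) - (x + y * Complex.I)) ^ 2)⁻¹)
      (𝓝[>] 0) (𝓝 ((∫ s, u s / (s - x) ^ 2 : ℝ) : ℂ)) := by
  rw [← integral_complex_ofReal]
  refine tendsto_integral_filter_of_dominated_convergence (fun s => ‖u s / (s - x) ^ 2‖) ?_ ?_
    hx.norm ?_
  · refine Eventually.of_forall fun y => Measurable.aestronglyMeasurable ?_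
    have := hu.measurable
    fun_prop
  · refine Eventually.of_forall fun y => Eventually.of_forall fun s => ?_
    by_cases h0 : u s = 0
    · simp [h0]
    have hsx : s - x ≠ 0 := fun h => h0 (by rw [sub_eq_zero.1 h]; exact hu.eq_zero hxF)
    rw [norm_mul, Complex.norm_real, norm_inv, norm_pow, norm_div, div_eq_mul_inv, norm_pow,
      Real.norm_eq_abs (s - x)]
    have := abs_pos.2 hsx
    gcongr
    exact abs_sub_le_norm_sub s x y
  · refine Eventually.of_forall fun s => ?_
    by_cases h0 : u s = 0
    · simp [h0]
    have hsx : s - x ≠ 0 := fun h => h0 (by rw [sub_eq_zero.1 h]; exact hu.eq_zero hxF)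
    rw [Complex.ofReal_div, div_eq_mul_inv, Complex.ofReal_pow]
    refine Tendsto.const_mul _ (((tendsto_sub_vertical s x).pow 2).inv₀ ?_)
    exact pow_ne_zero _ (by exact_mod_cast hsx)

/-- The bound `|u(s)| ≤ L |s - x|` cancels the singularity, so the Cauchy integral of `u` converges
absolutely at every point of `F`. -/
theorem div_abs_sub_le (hu : IsControlledBy u F L M R) {x : ℝ} (hxF : x ∈ F) (s : ℝ) :
    |u s| * |s - x|⁻¹ ≤ (Set.Icc (-R) R).indicator (fun _ => L) s := by
  by_cases h0 : u s = 0
  · simp only [h0, abs_zero, zero_mul]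
    exact Set.indicator_nonneg (fun _ _ => hu.const_nonneg) _
  have hsx : s - x ≠ 0 := fun h => h0 (by rw [sub_eq_zero.1 h]; exact hu.eq_zero hxF)
  rw [Set.indicator_of_mem (show s ∈ Set.Icc (-R) R from abs_le.1 (hu.support s h0)),
    ← div_eq_mul_inv, div_le_iff₀ (abs_pos.2 hsx)]
  exact hu.le_abs_sub hxF s

theorem integrable_indicator_const : Integrable ((Set.Icc (-R) R).indicator fun _ : ℝ => L) :=
  (integrableOn_const measure_Icc_lt_top.ne).integrable_indicator measurableSet_Icc

theorem integrable_div_sub (hu : IsControlledBy u F L M R) {x : ℝ} (hxF : x ∈ F) :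
    Integrable fun s => u s / (s - x) := by
  refine (integrable_indicator_const (R := R) (L := L)).mono'
    (hu.measurable.div (by fun_prop)).aestronglyMeasurable (Eventually.of_forall fun s => ?_)
  rw [norm_div, div_eq_mul_inv]
  exact hu.div_abs_sub_le hxF s

theorem tendsto_cauchy (hu : IsControlledBy u F L M R) {x : ℝ} (hxF : x ∈ F) :
    Tendsto (fun y : ℝ => IsBoundedDensity.cauchy u (x + y * Complex.I)) (𝓝[>] 0)
      (𝓝 ((∫ s, u s / (s - x) : ℝ) : ℂ)) := by
  rw [← integral_complex_ofReal]
  refine tendsto_integral_filter_of_dominated_convergence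
    ((Set.Icc (-R) R).indicator fun _ => L) ?_ ?_ integrable_indicator_const ?_
  · refine Eventually.of_forall fun y => Measurable.aestronglyMeasurable ?_
    have := hu.measurable
    fun_prop
  · refine Eventually.of_forall fun y => Eventually.of_forall fun s => ?_
    refine le_trans ?_ (hu.div_abs_sub_le hxF s)
    by_cases h0 : u s = 0
    · simp [h0]
    have hsx : s - x ≠ 0 := fun h => h0 (by rw [sub_eq_zero.1 h]; exact hu.eq_zero hxF)
    rw [norm_mul, Complex.norm_real, norm_inv, Real.norm_eq_abs]
    have := abs_pos.2 hsx
    gcongr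
    exact abs_sub_le_norm_sub s x y
  · refine Eventually.of_forall fun s => ?_
    by_cases h0 : u s = 0
    · simp [h0]
    have hsx : s - x ≠ 0 := fun h => h0 (by rw [sub_eq_zero.1 h]; exact hu.eq_zero hxF)
    rw [Complex.ofReal_div, div_eq_mul_inv]
    exact Tendsto.const_mul _ ((tendsto_sub_vertical s x).inv₀ (by exact_mod_cast hsx))

/-- Partial fractions under the integral; at `s = x` and `s = x'` the factor `u s` vanishes, so
default values of division do no harm. -/
theorem slope_integral_div_sub (hu : IsControlledBy u F L M R) {x x' : ℝ} (hx : x ∈ F)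
    (hx' : x' ∈ F) (hne : x' ≠ x) :
    slope (fun x => ∫ s, u s / (s - x)) x x' = ∫ s, u s / ((s - x') * (s - x)) := by
  rw [slope_def_field, ← integral_sub (hu.integrable_div_sub hx') (hu.integrable_div_sub hx),
    ← integral_div]
  refine integral_congr_ae (Eventually.of_forall fun s => ?_)
  simp only
  by_cases h0 : u s = 0
  · simp [h0]
  have h1 : s - x ≠ 0 := fun h => h0 (by rw [sub_eq_zero.1 h]; exact hu.eq_zero hx)
  have h2 : s - x' ≠ 0 := fun h => h0 (by rw [sub_eq_zero.1 h]; exact hu.eq_zero hx')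
  have h3 : x' - x ≠ 0 := sub_ne_zero.2 hne
  field_simp
  ring

/-- The part of the difference quotient that is dominated by the Marcinkiewicz integral. -/
theorem tendsto_far_part (hu : IsControlledBy u F L M R) {x : ℝ} (hxF : x ∈ F)
    (hx : Integrable fun s => u s / (s - x) ^ 2) :
    Tendsto (fun x' => ∫ s in {s | |s - x| ≤ 2 * |s - x'|}, u s / ((s - x') * (s - x)))
      (𝓝 x) (𝓝 (∫ s, u s / (s - x) ^ 2)) := by
  have hm : ∀ x', MeasurableSet {s | |s - x| ≤ 2 * |s - x'|} := fun x' =>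
    (isClosed_le (by fun_prop) (by fun_prop)).measurableSet
  simp_rw [← integral_indicator (hm _)]
  refine tendsto_integral_filter_of_dominated_convergence (fun s => 2 * ‖u s / (s - x) ^ 2‖) ?_ ?_
    (hx.norm.const_mul 2) ?_
  · refine Eventually.of_forall fun x' => Measurable.aestronglyMeasurable ?_
    exact (hu.measurable.div (by fun_prop)).indicator (hm _)
  · refine Eventually.of_forall fun x' => Eventually.of_forall fun s => ?_
    by_cases hs : s ∈ {s | |s - x| ≤ 2 * |s - x'|}
    · rw [Set.indicator_of_mem hs]
      by_cases h0 : u s = 0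
      · simp [h0]
      have h1 : 0 < |s - x| :=
        abs_pos.2 fun h => h0 (by rw [sub_eq_zero.1 h]; exact hu.eq_zero hxF)
      have h2 : |s - x| ≤ 2 * |s - x'| := hs
      have h3 : 0 < |s - x'| := by linarith
      rw [norm_div, norm_div, norm_mul, norm_pow, Real.norm_eq_abs (s - x), Real.norm_eq_abs (s - x'),
        mul_div_assoc', div_le_div_iff₀ (by positivity) (by positivity)]
      have h4 := norm_nonneg (u s)
      nlinarith [mul_nonneg h4 (mul_nonneg h1.le (sub_nonneg.2 h2))]
    · rw [Set.indicator_of_notMem hs, norm_zero]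
      positivity
  · refine Eventually.of_forall fun s => ?_
    by_cases h0 : u s = 0
    · have : ∀ x', ({s | |s - x| ≤ 2 * |s - x'|}).indicator
          (fun s => u s / ((s - x') * (s - x))) s = 0 := fun x' =>
        Set.indicator_apply_eq_zero.2 fun _ => by simp [h0]
      simp [this, h0]
    have h1 : s - x ≠ 0 := fun h => h0 (by rw [sub_eq_zero.1 h]; exact hu.eq_zero hxF)
    have h2 : Tendsto (fun x' => u s / ((s - x') * (s - x))) (𝓝 x) (𝓝 (u s / (s - x) ^ 2)) := by
      have : ContinuousAt (fun x' => u s / ((s - x') * (s - x))) x := by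
        refine ContinuousAt.div (by fun_prop) (by fun_prop) (mul_ne_zero h1 h1)
      simpa [sq] using this.tendsto
    refine h2.congr' ?_
    have h3 : ContinuousAt (fun x' => 2 * |s - x'|) x := by fun_prop
    have h4 : |s - x| < 2 * |s - x| := by linarith [abs_pos.2 h1]
    filter_upwards [h3.tendsto.eventually (lt_mem_nhds h4)] with x' hx'
    rw [Set.indicator_of_mem]
    exact le_of_lt hx'

/-- Let `h = |x' - x|`. Where `|s - x'| < |s - x|/2`, the triangle inequality gives `|s - x| < 2h`
and `2h ≤ 3 |s - x|`. The bound `|u(s)| ≤ L |s - x'|` cancels one factor and leaves an integrand of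
size at most `3L/(2h)`. It lives off `F`, within `2h` of `x`, so the integral is small when `x` is a
density point. -/
theorem norm_near_part_le (hu : IsControlledBy u F L M R) {x x' : ℝ}
    (hx'F : x' ∈ F) (hne : x' ≠ x) :
    ‖∫ s in {s | |s - x| ≤ 2 * |s - x'|}ᶜ, u s / ((s - x') * (s - x))‖
      ≤ 3 * L * (volume.real (Fᶜ ∩ Metric.closedBall x (2 * |x' - x|)) / (2 * |x' - x|)) := by
  set h := |x' - x| with hh
  have hpos : 0 < h := abs_pos.2 (sub_ne_zero.2 hne)
  have hm : MeasurableSet {s | |s - x| ≤ 2 * |s - x'|}ᶜ :=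
    (isClosed_le (by fun_prop) (by fun_prop)).measurableSet.compl
  have hmB : MeasurableSet (Fᶜ ∩ Metric.closedBall x (2 * h)) :=
    hu.isClosed.measurableSet.compl.inter Metric.isClosed_closedBall.measurableSet
  have hfin : volume (Fᶜ ∩ Metric.closedBall x (2 * h)) ≠ ⊤ :=
    measure_ne_top_of_subset Set.inter_subset_right measure_closedBall_lt_top.ne
  rw [← integral_indicator hm]
  have hI : Integrable ((Fᶜ ∩ Metric.closedBall x (2 * h)).indicator fun _ => 3 * L / (2 * h)) :=
    (integrableOn_const hfin).integrable_indicator hmB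
  refine (norm_integral_le_of_norm_le hI (Eventually.of_forall fun s => ?_)).trans_eq ?_
  · have hL := hu.const_nonneg
    by_cases hs : s ∈ {s | |s - x| ≤ 2 * |s - x'|}ᶜ
    · rw [Set.indicator_of_mem hs]
      by_cases h0 : u s = 0
      · simp only [h0, zero_div, norm_zero]
        exact Set.indicator_nonneg (fun _ _ => by positivity) _
      have hs' : 2 * |s - x'| < |s - x| := not_le.1 hs
      have t1 : |s - x| ≤ |s - x'| + h := by
        simpa [hh] using abs_sub_le s x' x
      have t2 : h ≤ |s - x'| + |s - x| := by
        have := abs_sub_le x' s x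
        rw [abs_sub_comm x' s] at this
        exact this
      have hx's : 0 < |s - x'| :=
        abs_pos.2 fun e => h0 (by rw [sub_eq_zero.1 e]; exact hu.eq_zero hx'F)
      have hmem : s ∈ Fᶜ ∩ Metric.closedBall x (2 * h) := by
        refine ⟨fun hF => h0 (hu.eq_zero hF), ?_⟩
        rw [Metric.mem_closedBall, Real.dist_eq]
        linarith
      rw [Set.indicator_of_mem hmem, norm_div, norm_mul, Real.norm_eq_abs, Real.norm_eq_abs,
        Real.norm_eq_abs, div_le_div_iff₀ (mul_pos hx's (by linarith)) (by positivity)]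
      have t3 := hu.le_abs_sub hx'F s
      calc |u s| * (2 * h) ≤ (L * |s - x'|) * (3 * |s - x|) :=
            mul_le_mul t3 (by linarith) (by positivity) (by positivity)
        _ = 3 * L * (|s - x'| * |s - x|) := by ring
    · rw [Set.indicator_of_notMem hs, norm_zero]
      exact Set.indicator_nonneg (fun _ _ => by positivity) _
  · rw [integral_indicator hmB, setIntegral_const, smul_eq_mul]
    ring

theorem hasDerivWithinAt_integral (hu : IsControlledBy u F L M R) {x : ℝ} (hxF : x ∈ F)
    (hxd : IsDensityPoint F x) (hx : Integrable fun s => u s / (s - x) ^ 2) :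
    HasDerivWithinAt (fun x => ∫ s, u s / (s - x)) (∫ s, u s / (s - x) ^ 2) F x := by
  rw [hasDerivWithinAt_iff_tendsto_slope]
  have h1 : Tendsto (fun x' => ∫ s in {s | |s - x| ≤ 2 * |s - x'|}, u s / ((s - x') * (s - x)))
      (𝓝[F \ {x}] x) (𝓝 (∫ s, u s / (s - x) ^ 2)) :=
    (hu.tendsto_far_part hxF hx).mono_left nhdsWithin_le_nhds
  have habs : Tendsto (fun x' => 2 * |x' - x|) (𝓝[F \ {x}] x) (𝓝[>] 0) := by
    refine tendsto_nhdsWithin_iff.2 ⟨?_, ?_⟩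
    · have : ContinuousAt (fun x' => 2 * |x' - x|) x := by fun_prop
      have h := this.tendsto
      simp only [sub_self, abs_zero, mul_zero] at h
      exact h.mono_left nhdsWithin_le_nhds
    · filter_upwards [self_mem_nhdsWithin] with x' hx'
      have : 0 < |x' - x| := abs_pos.2 (sub_ne_zero.2 hx'.2)
      simp only [Set.mem_Ioi]
      positivity
  have h2 : Tendsto (fun x' => ∫ s in {s | |s - x| ≤ 2 * |s - x'|}ᶜ, u s / ((s - x') * (s - x)))
      (𝓝[F \ {x}] x) (𝓝 0) := by
    have h3 := (Tendsto.comp hxd habs).const_mul (3 * L)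
    rw [mul_zero] at h3
    refine squeeze_zero_norm' ?_ h3
    filter_upwards [self_mem_nhdsWithin] with x' hx'
    exact hu.norm_near_part_le hx'.1 hx'.2
  have h3 := h1.add h2
  rw [add_zero] at h3
  refine h3.congr' ?_
  filter_upwards [self_mem_nhdsWithin] with x' hx'
  have hne : x' ≠ x := hx'.2
  rw [hu.slope_integral_div_sub hxF hx'.1 hne]
  refine integral_add_compl (isClosed_le (by fun_prop) (by fun_prop)).measurableSet ?_
  have h3 : x' - x ≠ 0 := sub_ne_zero.2 hne
  refine (((hu.integrable_div_sub hx'.1).sub (hu.integrable_div_sub hxF)).div_const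
    (x' - x)).congr (Eventually.of_forall fun s => ?_)
  simp only [Pi.sub_apply]
  by_cases h0 : u s = 0
  · simp [h0]
  have h1 : s - x ≠ 0 := fun h => h0 (by rw [sub_eq_zero.1 h]; exact hu.eq_zero hxF)
  have h2 : s - x' ≠ 0 := fun h => h0 (by rw [sub_eq_zero.1 h]; exact hu.eq_zero hx'.1)
  field_simp
  ring

end IsControlledBy

/-! ### Integration by parts -/

/-- Integration by parts against a measure with bounded support. -/
theorem integral_mul_eq_sub_integral_primitive {μ : Measure ℝ} [SFinite μ] {f : ℝ → ℝ}
    (hf : Integrable f μ) {R : ℝ} (hR : 0 ≤ R) (hsupp : ∀ᵐ t ∂μ, f t ≠ 0 → |t| ≤ R)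
    {Ψ Ψ' : ℝ → ℂ} (hΨ : ∀ t, HasDerivAt Ψ (Ψ' t) t) (hc : Continuous Ψ') :
    ∫ t, (f t : ℂ) * Ψ t ∂μ = (∫ t, f t ∂μ : ℝ) * Ψ R
      - ∫ s in (-R)..R, ((∫ t in Set.Iic s, f t ∂μ : ℝ) : ℂ) * Ψ' s := by
  have hRR : -R ≤ R := by linarith
  obtain ⟨C, hC⟩ := (isCompact_Icc (a := -R) (b := R)).exists_bound_of_continuousOn hc.continuousOn
  set ρ := volume.restrict (Set.Ioc (-R) R) with hρ
  -- On the support, `Ψ(t) = Ψ(R) - ∫ Ψ'(s) ds` over `t ≤ s ≤ R`. The indicator of `t ≤ s` makes the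
  -- inner domain independent of `t`, and exchanging the integrals produces the primitive of `f dμ`.
  let Φ : ℝ → ℝ → ℂ := fun t s => (f t : ℂ) * ({p : ℝ × ℝ | p.1 ≤ p.2}.indicator 1 (t, s) * Ψ' s)
  have hset : MeasurableSet {p : ℝ × ℝ | p.1 ≤ p.2} := measurableSet_le measurable_fst measurable_snd
  have hΦ : Integrable (Function.uncurry Φ) (μ.prod ρ) := by
    have h1 : Integrable (fun p : ℝ × ℝ => ‖f p.1‖ * C) (μ.prod ρ) :=
      (hf.norm.comp_fst ρ).mul_const C
    refine h1.mono' ?_ ?_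
    · refine AEStronglyMeasurable.mul ?_ ?_
      · exact (hf.ofReal (𝕜 := ℂ)).aestronglyMeasurable.comp_fst
      · refine AEStronglyMeasurable.mul ?_ (hc.comp continuous_snd).aestronglyMeasurable
        exact (measurable_one.indicator hset).aestronglyMeasurable
    · have h2 : ∀ᵐ s ∂ρ, ‖Ψ' s‖ ≤ C := by
        filter_upwards [ae_restrict_mem measurableSet_Ioc] with s hs
        exact hC s (Set.Ioc_subset_Icc_self hs)
      have h3 : ∀ᵐ p ∂μ.prod ρ, ‖Ψ' p.2‖ ≤ C := Measure.quasiMeasurePreserving_snd.ae h2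
      filter_upwards [h3] with p hp
      simp only [Function.uncurry, Φ]
      rw [norm_mul, norm_mul, Complex.norm_real]
      refine mul_le_mul_of_nonneg_left ?_ (norm_nonneg _)
      refine le_trans (mul_le_of_le_one_left (norm_nonneg _) ?_) hp
      by_cases h : (p.1, p.2) ∈ {p : ℝ × ℝ | p.1 ≤ p.2}
      · rw [Set.indicator_of_mem h]; simp
      · rw [Set.indicator_of_notMem h]; simp
  have hpt : ∀ᵐ t ∂μ, (f t : ℂ) * Ψ t = (f t : ℂ) * Ψ R - ∫ s, Φ t s ∂ρ := by
    filter_upwards [hsupp] with t ht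
    by_cases h0 : f t = 0
    · simp [Φ, h0]
    have htR := abs_le.1 (ht h0)
    have h1 : ∫ s, Φ t s ∂ρ = (f t : ℂ) * ∫ s in t..R, Ψ' s := by
      simp only [Φ]
      rw [integral_const_mul, intervalIntegral.integral_of_le htR.2, hρ]
      congr 1
      have e : ∀ s, {p : ℝ × ℝ | p.1 ≤ p.2}.indicator (1 : ℝ × ℝ → ℂ) (t, s) * Ψ' s
          = (Set.Ici t).indicator Ψ' s := by
        intro s
        by_cases hs : t ≤ s
        · rw [Set.indicator_of_mem (show (t, s) ∈ {p : ℝ × ℝ | p.1 ≤ p.2} from hs),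
            Set.indicator_of_mem (show s ∈ Set.Ici t from hs)]
          simp
        · rw [Set.indicator_of_notMem (show (t, s) ∉ {p : ℝ × ℝ | p.1 ≤ p.2} from hs),
            Set.indicator_of_notMem (show s ∉ Set.Ici t from hs), zero_mul]
      simp_rw [e]
      rw [integral_indicator measurableSet_Ici, Measure.restrict_restrict measurableSet_Ici]
      refine setIntegral_congr_set ?_
      have hae : (Set.Ici t : Set ℝ) =ᵐ[volume] Set.Ioi t := Ioi_ae_eq_Ici.symm
      refine (hae.inter (ae_eq_refl (Set.Ioc (-R) R))).trans ?_
      refine Eventually.of_forall fun s => ?_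
      refine propext ⟨fun h => ⟨h.1, h.2.2⟩, fun h => ⟨h.1, htR.1.trans_lt h.1, h.2⟩⟩
    rw [h1, intervalIntegral.integral_eq_sub_of_hasDerivAt (fun s _ => hΨ s)
      (hc.intervalIntegrable _ _)]
    ring
  have hΦ' : Integrable (fun t => ∫ s, Φ t s ∂ρ) μ := hΦ.integral_prod_left
  have hf' : Integrable (fun t => (f t : ℂ) * Ψ R) μ := hf.ofReal.mul_const _
  rw [integral_congr_ae hpt, integral_sub hf' hΦ',
    integral_mul_const, integral_complex_ofReal, integral_integral_swap hΦ,
    intervalIntegral.integral_of_le hRR]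
  congr 1
  refine integral_congr_ae (Eventually.of_forall fun s => ?_)
  simp only [Φ]
  rw [← integral_complex_ofReal, ← integral_mul_const, ← integral_indicator measurableSet_Iic]
  refine integral_congr_ae (Eventually.of_forall fun t => ?_)
  simp only
  by_cases hs : t ≤ s
  · rw [Set.indicator_of_mem (show (t, s) ∈ {p : ℝ × ℝ | p.1 ≤ p.2} from hs),
      Set.indicator_of_mem (show t ∈ Set.Iic s from hs)]
    simp
  · rw [Set.indicator_of_notMem (show (t, s) ∉ {p : ℝ × ℝ | p.1 ≤ p.2} from hs),
      Set.indicator_of_notMem (show t ∉ Set.Iic s from hs)]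
    simp

theorem hasDerivAt_log_sub_real {z : ℂ} (hz : 0 < z.im) (t : ℝ) :
    HasDerivAt (fun t : ℝ => Complex.log ((t : ℂ) - z)) (((t : ℂ) - z)⁻¹) t := by
  have h1 : HasDerivAt (fun t : ℝ => (t : ℂ) - z) 1 t :=
    (Complex.ofRealCLM.hasDerivAt (x := t)).sub_const z
  simpa using h1.clog_real (sub_mem_slitPlane_of_im_pos t hz)

theorem hasDerivAt_inv_sub_real {z : ℂ} (hz : 0 < z.im) (t : ℝ) :
    HasDerivAt (fun t : ℝ => ((t : ℂ) - z)⁻¹) (-(((t : ℂ) - z) ^ 2)⁻¹) t := by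
  have h1 : HasDerivAt (fun t : ℝ => (t : ℂ) - z) 1 t :=
    (Complex.ofRealCLM.hasDerivAt (x := t)).sub_const z
  have := h1.fun_inv (sub_ne_zero_of_im_pos t hz)
  rwa [neg_div, one_div] at this

/-! ### Lipschitz points and the splitting of a distribution function -/

/-- The points at which `k` has all its difference quotients bounded by `L`. -/
def lipschitzPoints (k : ℝ → ℝ) (L : ℝ) : Set ℝ := {x | ∀ y, |k x - k y| ≤ L * |x - y|}

theorem isClosed_lipschitzPoints {k : ℝ → ℝ} (hk : Continuous k) (L : ℝ) :
    IsClosed (lipschitzPoints k L) := by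
  simp only [lipschitzPoints, Set.ofPred_forall]
  exact isClosed_iInter fun y => isClosed_le (by fun_prop) (by fun_prop)

/-- Differentiability bounds the quotients for `y` near `x`; at distance at least `δ` they are at
most `B/δ`. -/
theorem exists_mem_lipschitzPoints {k : ℝ → ℝ} {B x : ℝ} (hB : ∀ y, |k x - k y| ≤ B)
    (hx : DifferentiableAt ℝ k x) : ∃ n : ℕ, 1 ≤ n ∧ x ∈ lipschitzPoints k n := by
  obtain ⟨C, hC⟩ := hx.isBigO_sub.bound
  obtain ⟨δ, hδ, hball⟩ := Metric.eventually_nhds_iff.1 hC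
  obtain ⟨n, hn⟩ := exists_nat_ge (max (max C (B / δ)) 1)
  have hn1 : (1 : ℝ) ≤ n := (le_max_right _ _).trans hn
  refine ⟨n, by exact_mod_cast hn1, fun y => ?_⟩
  by_cases hy : dist y x < δ
  · have := hball hy
    rw [Real.norm_eq_abs, Real.norm_eq_abs, abs_sub_comm, abs_sub_comm y x] at this
    refine this.trans (mul_le_mul_of_nonneg_right ?_ (abs_nonneg _))
    exact ((le_max_left _ _).trans (le_max_left _ _)).trans hn
  · have h1 : δ ≤ |x - y| := by
      rw [abs_sub_comm]
      exact not_lt.1 hy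
    have h2 : B / δ ≤ n := ((le_max_right _ _).trans (le_max_left _ _)).trans hn
    calc |k x - k y| ≤ B := hB y
      _ = B / δ * δ := by field_simp
      _ ≤ n * |x - y| := mul_le_mul h2 h1 hδ.le (by linarith)

/-- A continuous distribution function of a probability measure on a bounded interval. -/
structure IsBoundedCdf (k : ℝ → ℝ) (R : ℝ) : Prop where
  continuous : Continuous k
  monotone : Monotone k
  nonneg : ∀ t, 0 ≤ k t
  le_one : ∀ t, k t ≤ 1
  eq_zero : ∀ t, t ≤ -R → k t = 0
  eq_one : ∀ t, R ≤ t → k t = 1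

namespace IsBoundedCdf

variable {k : ℝ → ℝ} {R : ℝ}

theorem abs_sub_le_one (hk : IsBoundedCdf k R) (x y : ℝ) : |k x - k y| ≤ 1 := by
  rw [abs_le]
  constructor <;> linarith [hk.nonneg x, hk.nonneg y, hk.le_one x, hk.le_one y]

/-- Within distance `1` of such an `x` the function `k` is constant, and beyond that distance its
oscillation `1` is harmless. Hence the extension `K` agrees with `k` off `[-(R+1), R+1]`, and the
remainder has bounded support. -/
theorem mem_lipschitzPoints (hk : IsBoundedCdf k R) {L : ℝ} (hL : 1 ≤ L) {x : ℝ}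
    (hx : R + 1 ≤ |x|) : x ∈ lipschitzPoints k L := by
  intro y
  by_cases hxy : 1 ≤ |x - y|
  · exact (hk.abs_sub_le_one x y).trans (by nlinarith)
  have hxy' := abs_lt.1 (not_le.1 hxy)
  have : k x = k y := by
    rcases le_abs.1 hx with h | h
    · rw [hk.eq_one x (by linarith), hk.eq_one y (by linarith [hxy'.2])]
    · rw [hk.eq_zero x (by linarith), hk.eq_zero y (by linarith [hxy'.1])]
  rw [this, sub_self, abs_zero]
  positivity

/-- Splitting of a distribution function into a Lipschitz function and a remainder that is
controlled by the distance to the set of Lipschitz points. -/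
theorem exists_lipschitz_approx (hk : IsBoundedCdf k R) (hR : 0 < R) {n : ℕ} (hn : 1 ≤ n) :
    ∃ K : ℝ → ℝ, Continuous K ∧ IsBoundedDensity (deriv K) n (R + 1) ∧
      IsControlledBy (k - K) (lipschitzPoints k n) (2 * n) (2 * n * (2 * (R + 1))) (R + 1) ∧
      ∀ s, ∫ t in Set.Iic s, deriv K t = K s := by
  have hn1 : (1 : ℝ) ≤ n := by exact_mod_cast hn
  have hlip : LipschitzOnWith (n : NNReal) k (lipschitzPoints k n) :=
    LipschitzOnWith.of_dist_le_mul fun x hx y _ => by simpa [Real.dist_eq] using hx y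
  obtain ⟨K, hK, hKk⟩ := hlip.extend_real
  have hK0 : ∀ t, t ≤ -(R + 1) → K t = 0 := fun t ht => by
    rw [← hKk (hk.mem_lipschitzPoints hn1 (by rw [le_abs]; right; linarith)),
      hk.eq_zero t (by linarith)]
  have hK1 : ∀ t, R + 1 ≤ t → K t = 1 := fun t ht => by
    rw [← hKk (hk.mem_lipschitzPoints hn1 (by rw [le_abs]; left; linarith)),
      hk.eq_one t (by linarith)]
  have hsupp : ∀ t, deriv K t ≠ 0 → |t| ≤ R + 1 := by
    intro t ht
    by_contra hcon
    refine ht ?_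
    rcases lt_abs.1 (not_le.1 hcon) with h | h
    · have : K =ᶠ[𝓝 t] fun _ => 1 := by
        filter_upwards [lt_mem_nhds h] with s hs using hK1 s hs.le
      rw [this.deriv_eq, deriv_const]
    · have : K =ᶠ[𝓝 t] fun _ => 0 := by
        filter_upwards [gt_mem_nhds (show t < -(R + 1) by linarith)] with s hs using hK0 s hs.le
      rw [this.deriv_eq, deriv_const]
  have hdens : IsBoundedDensity (deriv K) n (R + 1) :=
    ⟨measurable_deriv K, fun t => by simpa using norm_deriv_le_of_lipschitz (x₀ := t) hK, hsupp⟩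
  -- As `K = k` at `x`, the remainder at `s` is a difference of increments of `K` and `k`, each at
  -- most `n |s - x|`; hence the constant `2n`.
  have hdist : ∀ s, ∀ x ∈ lipschitzPoints k n, |(k - K) s| ≤ 2 * n * |s - x| := by
    intro s x hx
    have h1 := hx s
    have h2 := hK.dist_le_mul x s
    rw [Real.dist_eq, Real.dist_eq] at h2
    have h2' : |K x - K s| ≤ n * |x - s| := by simpa using h2
    have h3 : (k - K) s = (K x - K s) - (k x - k s) := by
      rw [← hKk hx, Pi.sub_apply]; ring
    rw [h3, abs_sub_comm s x]
    exact (abs_sub _ _).trans (by linarith)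
  have hmem : R + 1 ∈ lipschitzPoints k n := hk.mem_lipschitzPoints hn1 (le_abs_self _)
  have hne : (lipschitzPoints k n).Nonempty := ⟨R + 1, hmem⟩
  have hcl : IsClosed (lipschitzPoints k n) := isClosed_lipschitzPoints hk.continuous n
  have husupp : ∀ t, (k - K) t ≠ 0 → |t| ≤ R + 1 := by
    intro t ht
    by_contra hcon
    refine ht ?_
    rw [Pi.sub_apply, ← hKk (hk.mem_lipschitzPoints hn1 (not_le.1 hcon).le), sub_self]
  refine ⟨K, hK.continuous, hdens, ⟨⟨?_, ?_, husupp⟩, hcl, hne, ?_, by positivity⟩, ?_⟩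
  · exact (hk.continuous.sub hK.continuous).measurable
  · intro t
    by_cases h0 : (k - K) t = 0
    · rw [h0, abs_zero]; positivity
    have ht := abs_le.1 (husupp t h0)
    refine (hdist t _ hmem).trans (mul_le_mul_of_nonneg_left ?_ (by positivity))
    rw [abs_le]
    constructor <;> linarith [ht.1, ht.2]
  · intro s
    obtain ⟨x, hx, hxs⟩ := hcl.exists_infDist_eq_dist hne s
    rw [hxs]
    exact hdist s x hx
  · intro s
    -- A starting point at most `s` where `K` vanishes, which covers `s < -(R + 1)` as well.
    set m := min s (-(R + 1)) with hm
    have hms : m ≤ s := min_le_left _ _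
    have hac : AbsolutelyContinuousOnInterval K m s :=
      (hK.lipschitzOnWith (s := Set.uIcc m s)).absolutelyContinuousOnInterval
    have h1 := hac.integral_deriv_eq_sub
    rw [hK0 m (min_le_right _ _), sub_zero, intervalIntegral.integral_of_le hms] at h1
    rw [← h1]
    refine (setIntegral_eq_of_subset_of_ae_sdiff_eq_zero measurableSet_Iic.nullMeasurableSet
      Set.Ioc_subset_Iic_self ?_)
    have hne' : ∀ᵐ t : ℝ, t ≠ -(R + 1) := by simp [ae_iff]
    filter_upwards [hne'] with t hne' ht
    by_contra h0
    have h2 := abs_le.1 (hsupp t h0)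
    have h3 : ¬ m < t := fun h => ht.2 ⟨h, ht.1⟩
    exact hne' (le_antisymm ((not_lt.1 h3).trans (min_le_right _ _)) h2.1)

end IsBoundedCdf

/-! ### Approximate differentiability of the potential of a measure -/

theorem intervalIntegral_eq_integral_of_support {u : ℝ → ℝ} {R : ℝ} (hR : 0 ≤ R)
    (hu : ∀ t, u t ≠ 0 → |t| ≤ R) (Ψ : ℝ → ℂ) :
    ∫ s in (-R)..R, (u s : ℂ) * Ψ s = ∫ s, (u s : ℂ) * Ψ s := by
  rw [intervalIntegral.integral_of_le (by linarith), ← integral_Icc_eq_integral_Ioc]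
  refine setIntegral_eq_integral_of_forall_compl_eq_zero fun s hs => ?_
  by_cases h0 : u s = 0
  · simp [h0]
  · exact absurd (abs_le.1 (hu s h0)) hs

section Main

variable {ν : Measure ℝ} [IsProbabilityMeasure ν] {R : ℝ}

theorem IsBoundedCdf.ae_abs_le (hk : IsBoundedCdf (ProbabilityTheory.cdf ν) R) :
    ∀ᵐ t ∂ν, |t| ≤ R := by
  have h1 : ν (Set.Iic (-R)) = 0 := by
    rw [← ProbabilityTheory.ofReal_cdf, hk.eq_zero _ le_rfl, ENNReal.ofReal_zero]
  have h2 : ν (Set.Ioi R) = 0 := by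
    rw [← Set.compl_Iic, prob_compl_eq_zero_iff measurableSet_Iic, ← ProbabilityTheory.ofReal_cdf,
      hk.eq_one _ le_rfl, ENNReal.ofReal_one]
  filter_upwards [measure_eq_zero_iff_ae_notMem.1 h1, measure_eq_zero_iff_ae_notMem.1 h2]
    with t ht1 ht2
  rw [abs_le]
  exact ⟨(not_le.1 ht1).le, not_lt.1 ht2⟩

/-- Integrals against `ν` and against the density of a Lipschitz approximation of its
distribution function. -/
theorem IsBoundedCdf.integral_sub_integral (hk : IsBoundedCdf (ProbabilityTheory.cdf ν) R)
    (hR : 0 < R) {K : ℝ → ℝ} {n M L : ℝ} {F : Set ℝ} (hd : IsBoundedDensity (deriv K) n (R + 1))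
    (hu : IsControlledBy (⇑(ProbabilityTheory.cdf ν) - K) F L M (R + 1))
    (hcK : Continuous K)
    (hK : ∀ s, ∫ t in Set.Iic s, deriv K t = K s) (hK1 : ∫ t, deriv K t = 1)
    {Ψ Ψ' : ℝ → ℂ} (hΨ : ∀ t, HasDerivAt Ψ (Ψ' t) t) (hc : Continuous Ψ') :
    ∫ t, Ψ t ∂ν = (∫ t, ((deriv K t : ℝ) : ℂ) * Ψ t)
      - ∫ s, (((⇑(ProbabilityTheory.cdf ν) - K) s : ℝ) : ℂ) * Ψ' s := by
  have hR1 : 0 ≤ R + 1 := by linarith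
  have h1 := integral_mul_eq_sub_integral_primitive (μ := ν) (f := fun _ => 1)
    (integrable_const 1) hR1 (hk.ae_abs_le.mono fun t ht _ => by linarith) hΨ hc
  have h2 := integral_mul_eq_sub_integral_primitive (μ := volume) hd.integrable hR1
    (Eventually.of_forall hd.support) hΨ hc
  simp only [Complex.ofReal_one, one_mul, integral_const, probReal_univ, smul_eq_mul,
    mul_one, measureReal_restrict_apply_univ] at h1
  rw [hK1, Complex.ofReal_one, one_mul] at h2
  simp_rw [hK] at h2
  simp_rw [← ProbabilityTheory.cdf_eq_real] at h1
  have i1 : IntervalIntegrable (fun s => ((ProbabilityTheory.cdf ν s : ℝ) : ℂ) * Ψ' s) volume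
      (-(R + 1)) (R + 1) :=
    ((Complex.continuous_ofReal.comp hk.continuous).mul hc).intervalIntegrable _ _
  have i2 : IntervalIntegrable (fun s => (K s : ℂ) * Ψ' s) volume (-(R + 1)) (R + 1) :=
    ((Complex.continuous_ofReal.comp hcK).mul hc).intervalIntegrable _ _
  rw [← intervalIntegral_eq_integral_of_support hR1 hu.support, h1, h2]
  have h3 : ∫ s in (-(R + 1))..(R + 1), (((⇑(ProbabilityTheory.cdf ν) - K) s : ℝ) : ℂ) * Ψ' s
      = (∫ s in (-(R + 1))..(R + 1), ((ProbabilityTheory.cdf ν s : ℝ) : ℂ) * Ψ' s)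
        - ∫ s in (-(R + 1))..(R + 1), (K s : ℂ) * Ψ' s := by
    rw [← intervalIntegral.integral_sub i1 i2]
    congr 1
    funext s
    rw [Pi.sub_apply, Complex.ofReal_sub, sub_mul]
  rw [h3]
  ring

/-- The logarithmic potential of a compactly supported probability measure with finite boundary
values everywhere is approximately differentiable almost everywhere. -/
theorem IsBoundedCdf.ae_hasApproxDerivAt (hk : IsBoundedCdf (ProbabilityTheory.cdf ν) R)
    (hR : 0 < R) {γ : ℝ → ℝ}
    (hγ : ∀ x : ℝ, Tendsto (fun y : ℝ => (∫ t : ℝ, Complex.log ((t : ℂ) - (x + y * Complex.I)) ∂ν).re)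
      (𝓝[>] 0) (𝓝 (γ x))) :
    ∀ᵐ x : ℝ, ∃ g : ℂ,
      Tendsto (fun y : ℝ => ∫ t : ℝ, ((t : ℂ) - (x + y * Complex.I))⁻¹ ∂ν) (𝓝[>] 0) (𝓝 g) ∧
      HasApproxDerivAt γ (-g.re) x := by
  set k : ℝ → ℝ := ⇑(ProbabilityTheory.cdf ν) with hkdef
  have main : ∀ n : ℕ, 1 ≤ n → ∀ᵐ x : ℝ, x ∈ lipschitzPoints k n → ∃ g : ℂ,
      Tendsto (fun y : ℝ => ∫ t : ℝ, ((t : ℂ) - (x + y * Complex.I))⁻¹ ∂ν) (𝓝[>] 0) (𝓝 g) ∧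
      HasApproxDerivAt γ (-g.re) x := by
    intro n hn
    obtain ⟨K, hcK, hd, hu, hK⟩ := hk.exists_lipschitz_approx hR hn
    have hKR : ∀ s, R + 1 ≤ s → K s = 1 := by
      intro s hs
      have h1 : s ∈ lipschitzPoints k n :=
        hk.mem_lipschitzPoints (by exact_mod_cast hn) (hs.trans (le_abs_self _))
      have h2 := hu.eq_zero h1
      rw [Pi.sub_apply, hk.eq_one s (by linarith)] at h2
      linarith
    have hK1 : ∫ t, deriv K t = 1 := by
      rw [← hKR (R + 1) le_rfl, ← hK]
      refine (setIntegral_eq_integral_of_forall_compl_eq_zero fun t ht => ?_).symm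
      by_contra h0
      exact ht ((abs_le.1 (hd.support t h0)).2)
    have hlog : ∀ {z : ℂ}, 0 < z.im → ∫ t : ℝ, Complex.log ((t : ℂ) - z) ∂ν
        = (∫ t, ((deriv K t : ℝ) : ℂ) * Complex.log ((t : ℂ) - z))
          - IsBoundedDensity.cauchy (k - K) z := fun hz =>
      hk.integral_sub_integral hR hd hu hcK hK hK1 (hasDerivAt_log_sub_real hz) (continuous_inv_sub hz)
    have hinv : ∀ {z : ℂ}, 0 < z.im → ∫ t : ℝ, ((t : ℂ) - z)⁻¹ ∂ν
        = IsBoundedDensity.cauchy (deriv K) z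
          + ∫ s, (((k - K) s : ℝ) : ℂ) * (((s : ℂ) - z) ^ 2)⁻¹ := fun {z} hz => by
      have hc : Continuous fun t : ℝ => -(((t : ℂ) - z) ^ 2)⁻¹ := by
        exact ((continuous_inv_sub hz).pow 2).neg.congr fun t => by simp
      rw [hk.integral_sub_integral hR hd hu hcK hK hK1 (hasDerivAt_inv_sub_real hz) hc,
        IsBoundedDensity.cauchy]
      simp_rw [mul_neg]
      rw [integral_neg, sub_neg_eq_add]
    -- This representation is obtained only on the Lipschitz set, where the remainder integral is
    -- controlled. It therefore yields a derivative within that set, not a full derivative.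
    have hγF : ∀ x ∈ lipschitzPoints k n,
        γ x = IsBoundedDensity.logPotential (deriv K) x - ∫ s, (k - K) s / (s - x) := by
      intro x hx
      refine tendsto_nhds_unique (hγ x) ?_
      have h1 := (hd.tendsto_re_integral_log x).sub
        ((Complex.continuous_re.tendsto _).comp (hu.tendsto_cauchy hx))
      rw [Complex.ofReal_re] at h1
      refine h1.congr' ?_
      filter_upwards [self_mem_nhdsWithin] with y hy
      rw [hlog (z := x + y * Complex.I) (by simpa using hy), Complex.sub_re]
      rfl
    filter_upwards [hd.ae_tendsto_cauchy, hu.ae_integrable_inv_sq,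
      ae_isDensityPoint hu.isClosed.measurableSet] with x ⟨g₁, hg₁, hg₁'⟩ hM hdens hx
    refine ⟨g₁ + (∫ s, (k - K) s / (s - x) ^ 2 : ℝ), ?_, ?_⟩
    · refine (hg₁.add (hu.tendsto_integral_inv_sq hx (hM hx))).congr' ?_
      filter_upwards [self_mem_nhdsWithin] with y hy
      exact (hinv (z := x + y * Complex.I) (by simpa using hy)).symm
    · refine HasDerivWithinAt.hasApproxDerivAt (F := lipschitzPoints k n) ?_ (hdens hx)
      have h1 := hg₁'.hasDerivWithinAt.sub
        (hu.hasDerivWithinAt_integral hx (hdens hx) (hM hx))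
      have h2 : -(g₁ + ((∫ s, (k - K) s / (s - x) ^ 2 : ℝ) : ℂ)).re
          = -g₁.re - ∫ s, (k - K) s / (s - x) ^ 2 := by
        rw [Complex.add_re, Complex.ofReal_re]; ring
      rw [h2]
      exact h1.congr hγF (hγF x hx)
  have main' : ∀ᵐ x : ℝ, ∀ n : ℕ, 1 ≤ n → x ∈ lipschitzPoints k n → ∃ g : ℂ,
      Tendsto (fun y : ℝ => ∫ t : ℝ, ((t : ℂ) - (x + y * Complex.I))⁻¹ ∂ν) (𝓝[>] 0) (𝓝 g) ∧
      HasApproxDerivAt γ (-g.re) x := by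
    rw [ae_all_iff]
    intro n
    by_cases hn : 1 ≤ n
    · filter_upwards [main n hn] with x hx _ using hx
    · exact Eventually.of_forall fun x h => absurd h hn
  filter_upwards [main', hk.monotone.ae_differentiableAt] with x hx hdiff
  obtain ⟨n, hn, hmem⟩ := exists_mem_lipschitzPoints (hk.abs_sub_le_one x) hdiff
  exact hx n hn hmem

end Main

/-! ### Boundary values of `w` -/

theorem isOpen_upperHalf : IsOpen upperHalf := isOpen_lt continuous_const Complex.continuous_im

theorem isPreconnected_upperHalf : IsPreconnected upperHalf :=
  (convex_halfSpace_im_gt 0).isPreconnected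

theorem HasApproxDerivAt.sub_const {f : ℝ → ℝ} {d x : ℝ} (h : HasApproxDerivAt f d x) (c : ℝ) :
    HasApproxDerivAt (fun t => f t - c) d x := by
  simpa only [HasApproxDerivAt, sub_sub_sub_cancel_right] using h

section

variable {ν : Measure ℝ} [IsProbabilityMeasure ν] {R : ℝ}

theorem integrable_log_sub (hR : ∀ᵐ t ∂ν, |t| ≤ R) {z : ℂ} (hz : 0 < z.im) :
    Integrable (fun t : ℝ => Complex.log ((t : ℂ) - z)) ν := by
  have := integrable_mul_log_sub (μ := ν) (f := fun _ => 1) (integrable_const 1)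
    (hR.mono fun t ht _ => ht) hz
  simpa using this

theorem hasDerivAt_integral_log (hR : ∀ᵐ t ∂ν, |t| ≤ R) {z : ℂ} (hz : 0 < z.im) :
    HasDerivAt (fun z : ℂ => ∫ t : ℝ, Complex.log ((t : ℂ) - z) ∂ν)
      (-∫ t : ℝ, ((t : ℂ) - z)⁻¹ ∂ν) z := by
  have := hasDerivAt_integral_log_sub (μ := ν) (f := fun _ => 1) (integrable_const 1)
    (hR.mono fun t ht _ => ht) hz
  simpa using this

theorem integral_log_re (hR : ∀ᵐ t ∂ν, |t| ≤ R) {z : ℂ} (hz : 0 < z.im) :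
    (∫ t : ℝ, Complex.log ((t : ℂ) - z) ∂ν).re = ∫ t : ℝ, Real.log ‖(t : ℂ) - z‖ ∂ν := by
  rw [← RCLike.re_eq_complex_re, ← integral_re (integrable_log_sub hR hz)]
  simp [Complex.log_re]

theorem integral_log_im (hR : ∀ᵐ t ∂ν, |t| ≤ R) {z : ℂ} (hz : 0 < z.im) :
    (∫ t : ℝ, Complex.log ((t : ℂ) - z) ∂ν).im = ∫ t : ℝ, Complex.arg ((t : ℂ) - z) ∂ν := by
  rw [← RCLike.im_eq_complex_im, ← integral_im (integrable_log_sub hR hz)]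
  simp [Complex.log_im]

theorem integrable_log_norm_sub (hR : ∀ᵐ t ∂ν, |t| ≤ R) {z : ℂ} (hz : 0 < z.im) :
    Integrable (fun t : ℝ => Real.log ‖(t : ℂ) - z‖) ν := by
  simpa [Complex.log_re] using (integrable_log_sub hR hz).re

theorem tendsto_arg_sub {t x : ℝ} (h : t ≠ x) :
    Tendsto (fun y : ℝ => Complex.arg ((t : ℂ) - (x + y * Complex.I))) (𝓝[>] 0)
      (𝓝 ((Set.Iic x).indicator (fun _ => -Real.pi) t)) := by
  have h0 := IsControlledBy.tendsto_sub_vertical t x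
  rcases lt_or_gt_of_ne h with h | h
  · rw [Set.indicator_of_mem (show t ∈ Set.Iic x from h.le)]
    have h1 : Tendsto (fun y : ℝ => (t : ℂ) - (x + y * Complex.I)) (𝓝[>] 0)
        (𝓝[{z : ℂ | z.im < 0}] ((t - x : ℝ) : ℂ)) := by
      refine tendsto_nhdsWithin_iff.2 ⟨h0, ?_⟩
      filter_upwards [self_mem_nhdsWithin] with y hy
      simpa using hy
    exact (Complex.tendsto_arg_nhdsWithin_im_neg_of_re_neg_of_im_zero
      (by rw [Complex.ofReal_re]; linarith) (by simp)).comp h1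
  · rw [Set.indicator_of_notMem (show t ∉ Set.Iic x from not_le.2 h)]
    have hs : ((t - x : ℝ) : ℂ) ∈ Complex.slitPlane := by
      rw [Complex.mem_slitPlane_iff]; left; rw [Complex.ofReal_re]; linarith
    have h1 := (Complex.continuousAt_arg hs).tendsto.comp h0
    rwa [Complex.arg_ofReal_of_nonneg (by linarith)] at h1

/-- For `z` in the upper half plane `t - z` lies in the lower one, so its argument tends to `-π` for
`t < x` and to `0` for `t > x`. At `t = x` it is constantly `-π/2`, which is why `x` must not be an
atom. -/
theorem tendsto_integral_log_im (hR : ∀ᵐ t ∂ν, |t| ≤ R) {x : ℝ} (hx : ν {x} = 0) :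
    Tendsto (fun y : ℝ => (∫ t : ℝ, Complex.log ((t : ℂ) - (x + y * Complex.I)) ∂ν).im) (𝓝[>] 0)
      (𝓝 (-(Real.pi * ProbabilityTheory.cdf ν x))) := by
  have h1 : Tendsto (fun y : ℝ => ∫ t : ℝ, Complex.arg ((t : ℂ) - (x + y * Complex.I)) ∂ν)
      (𝓝[>] 0) (𝓝 (∫ t, (Set.Iic x).indicator (fun _ => -Real.pi) t ∂ν)) := by
    refine tendsto_integral_filter_of_dominated_convergence (fun _ => Real.pi) ?_ ?_
      (integrable_const _) ?_
    · refine Eventually.of_forall fun y => Measurable.aestronglyMeasurable ?_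
      exact Complex.measurable_arg.comp (by fun_prop)
    · exact Eventually.of_forall fun y => Eventually.of_forall fun t => Complex.abs_arg_le_pi _
    · filter_upwards [measure_eq_zero_iff_ae_notMem.1 hx] with t ht
      exact tendsto_arg_sub ht
  rw [integral_indicator measurableSet_Iic, setIntegral_const, ← ProbabilityTheory.cdf_eq_real,
    smul_eq_mul, mul_neg, mul_comm] at h1
  refine h1.congr' ?_
  filter_upwards [self_mem_nhdsWithin] with y hy
  exact (integral_log_im hR (by simpa using hy)).symm

theorem log_norm_sub_le {t x y : ℝ} (ht : |t| ≤ R) (hy : 0 < y) (hy1 : y ≤ 1) :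
    Real.log ‖(t : ℂ) - (x + y * Complex.I)‖ ≤ R + |x| := by
  have hpos : 0 < ‖(t : ℂ) - (x + y * Complex.I)‖ :=
    norm_pos_iff.2 (sub_ne_zero_of_im_pos t (by simpa using hy))
  have h1 := Real.log_le_sub_one_of_pos hpos
  have h2 : ‖(t : ℂ) - (x + y * Complex.I)‖ ≤ |t| + (|x| + y) := by
    refine (norm_sub_le _ _).trans (add_le_add ?_ ((norm_add_le _ _).trans (add_le_add ?_ ?_)))
    · rw [Complex.norm_real, Real.norm_eq_abs]
    · rw [Complex.norm_real, Real.norm_eq_abs]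
    · rw [norm_mul, Complex.norm_I, mul_one, Complex.norm_real, Real.norm_eq_abs, abs_of_pos hy]
  linarith

/-- A measure whose logarithmic potential is bounded below has no atoms. -/
theorem measure_singleton_eq_zero (hR : ∀ᵐ t ∂ν, |t| ≤ R) {c : ℝ}
    (hc : ∀ z : ℂ, 0 < z.im → c ≤ ∫ t : ℝ, Real.log ‖(t : ℂ) - z‖ ∂ν) (x : ℝ) : ν {x} = 0 := by
  -- The atom contributes its mass times `log y`, and the rest is bounded above as `y → 0`; a
  -- positive mass would send the potential to `-∞`.
  have hb : ∀ y ∈ Set.Ioo (0 : ℝ) 1, c ≤ ν.real {x} * Real.log y + (R + |x|) := by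
    intro y hy
    have hz : 0 < ((x : ℂ) + y * Complex.I).im := by simpa using hy.1
    have hR0 : 0 ≤ R := by
      obtain ⟨t, ht⟩ := hR.exists
      exact (abs_nonneg t).trans ht
    refine (hc _ hz).trans ?_
    have hi : Integrable (fun t => ({x} : Set ℝ).indicator (fun _ => Real.log y) t) ν :=
      (integrable_const _).indicator (measurableSet_singleton x)
    have : ∫ t : ℝ, Real.log ‖(t : ℂ) - (x + y * Complex.I)‖ ∂ν
        ≤ ∫ t, (({x} : Set ℝ).indicator (fun _ => Real.log y) t + (R + |x|)) ∂ν := by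
      refine integral_mono_ae (integrable_log_norm_sub hR hz) (hi.add (integrable_const _)) ?_
      filter_upwards [hR] with t ht
      by_cases h : t = x
      · have e : ‖(t : ℂ) - (x + y * Complex.I)‖ = y := by
          rw [h, sub_add_cancel_left, norm_neg, norm_mul, Complex.norm_I, mul_one,
            Complex.norm_real, Real.norm_eq_abs, abs_of_pos hy.1]
        rw [e, Set.indicator_of_mem (by simpa using h)]
        linarith [abs_nonneg x]
      · rw [Set.indicator_of_notMem (by simpa using h), zero_add]
        exact log_norm_sub_le ht hy.1 hy.2.le
    rw [integral_add hi (integrable_const _), integral_const, probReal_univ, one_smul,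
      integral_indicator (measurableSet_singleton x), setIntegral_const, smul_eq_mul] at this
    exact this
  by_contra hne
  have hpos : 0 < ν.real {x} := ENNReal.toReal_pos hne (measure_ne_top _ _)
  have hlim : Tendsto (fun y : ℝ => ν.real {x} * Real.log y + (R + |x|)) (𝓝[>] 0) atBot :=
    tendsto_atBot_add_const_right _ _ (Real.tendsto_log_nhdsGT_zero.const_mul_atBot hpos)
  obtain ⟨y, hy1, hy2⟩ := ((hlim.eventually (eventually_lt_atBot c)).and
    (Ioo_mem_nhdsGT (one_pos (α := ℝ)))).exists
  exact absurd (hb y hy2) (not_le.2 hy1)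

theorem isBoundedCdf_cdf (hR : ∀ᵐ t ∂ν, |t| ≤ R) (hatom : ∀ x, ν {x} = 0) :
    IsBoundedCdf (ProbabilityTheory.cdf ν) (R + 1) := by
  refine ⟨?_, ProbabilityTheory.monotone_cdf ν, ProbabilityTheory.cdf_nonneg ν,
    ProbabilityTheory.cdf_le_one ν, fun t ht => ?_, fun t ht => ?_⟩
  · rw [continuous_iff_continuousAt]
    intro x
    have h1 := (ProbabilityTheory.cdf ν).measure_singleton x
    rw [ProbabilityTheory.measure_cdf, hatom] at h1
    have h2 := ENNReal.ofReal_eq_zero.1 h1.symm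
    have h3 := (ProbabilityTheory.monotone_cdf ν).leftLim_le (le_refl x)
    rw [(ProbabilityTheory.monotone_cdf ν).continuousAt_iff_leftLim_eq_rightLim,
      StieltjesFunction.rightLim_eq]
    linarith
  · rw [ProbabilityTheory.cdf_eq_real, measureReal_eq_zero_iff, measure_eq_zero_iff_ae_notMem]
    filter_upwards [hR] with s hs h
    have h1 := (abs_le.1 hs).1
    have h2 : s ≤ t := h
    linarith
  · rw [ProbabilityTheory.cdf_eq_real, measureReal_def]
    have : ν (Set.Iic t) = 1 := by
      refine (prob_compl_eq_zero_iff measurableSet_Iic).1 (measure_eq_zero_iff_ae_notMem.2 ?_)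
      filter_upwards [hR] with s hs h
      exact h (show s ≤ t by linarith [(abs_le.1 hs).2])
    rw [this, ENNReal.toReal_one]

/-- The distance from `t` to `x + iy` increases with `y`. With the lower bound on the potential this
makes the limit as `y → 0` exist and be finite at every `x`, not just almost everywhere. -/
theorem monotoneOn_integral_log_norm (hR : ∀ᵐ t ∂ν, |t| ≤ R) (x : ℝ) :
    MonotoneOn (fun y : ℝ => ∫ t : ℝ, Real.log ‖(t : ℂ) - (x + y * Complex.I)‖ ∂ν) (Set.Ioi 0) := by
  intro y hy y' hy' hyy
  have hy : 0 < y := hy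
  have hy' : 0 < y' := hy'
  refine integral_mono (integrable_log_norm_sub hR (by simpa using hy))
    (integrable_log_norm_sub hR (by simpa using hy')) fun t => ?_
  refine Real.log_le_log (norm_pos_iff.2 (sub_ne_zero_of_im_pos t (by simpa using hy))) ?_
  have e : ∀ y : ℝ, ‖(t : ℂ) - (x + y * Complex.I)‖ = Real.sqrt ((t - x) ^ 2 + y ^ 2) := by
    intro y
    rw [Complex.norm_def, Complex.normSq_apply]
    simp
    ring_nf
  rw [e, e]
  gcongr

/-- Boundary values of a function on the upper half plane whose derivative is the Borel transform
of a compactly supported probability measure. -/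
theorem exists_boundary_values {w : ℂ → ℂ} (hR : ∀ᵐ t ∂ν, |t| ≤ R)
    (hw : ∀ z ∈ upperHalf, HasDerivAt w (∫ t : ℝ, ((t : ℂ) - z)⁻¹ ∂ν) z)
    (hre : ∀ z ∈ upperHalf, (w z).re ≤ 0) (him : ∀ z ∈ upperHalf, 0 ≤ (w z).im)
    (him' : ∀ z ∈ upperHalf, (w z).im ≤ Real.pi) :
    ∃ (γ : ℝ → ℝ) (k : StieltjesFunction ℝ),
      IsLyapunovExponent w γ ∧ IsIntegratedDensityOfStates w k ∧
      IsProbabilityMeasure k.measure ∧ Measurable γ ∧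
      ∀ᵐ x : ℝ, ∃ g : ℂ,
        Tendsto (fun y : ℝ => borelTransform k.measure (x + y * Complex.I)) (𝓝[>] 0) (𝓝 g) ∧
        HasApproxDerivAt γ (-g.re) x := by
  obtain ⟨c, hc⟩ : ∃ c, ∀ z ∈ upperHalf, w z + ∫ t : ℝ, Complex.log ((t : ℂ) - z) ∂ν = c := by
    have hd : ∀ z ∈ upperHalf,
        HasDerivAt (fun z => w z + ∫ t : ℝ, Complex.log ((t : ℂ) - z) ∂ν) 0 z := fun z hz => by
      have := (hw z hz).add (hasDerivAt_integral_log hR hz)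
      rwa [add_neg_cancel] at this
    exact isOpen_upperHalf.exists_is_const_of_deriv_eq_zero isPreconnected_upperHalf
      (fun z hz => (hd z hz).differentiableAt.differentiableWithinAt) (fun z hz => (hd z hz).deriv)
  have hwz : ∀ z ∈ upperHalf, w z = c - ∫ t : ℝ, Complex.log ((t : ℂ) - z) ∂ν := fun z hz =>
    eq_sub_of_add_eq (hc z hz)
  have hmem : ∀ (x : ℝ) {y : ℝ}, 0 < y → (x : ℂ) + y * Complex.I ∈ upperHalf := fun x y hy => by
    simpa [upperHalf] using hy
  have hlow : ∀ z : ℂ, 0 < z.im → c.re ≤ ∫ t : ℝ, Real.log ‖(t : ℂ) - z‖ ∂ν := fun z hz => by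
    have := hre z hz
    rw [hwz z hz, Complex.sub_re, integral_log_re hR hz] at this
    linarith
  have hatom := measure_singleton_eq_zero hR hlow
  have hcdf := isBoundedCdf_cdf hR hatom
  have himlim : ∀ x : ℝ, Tendsto (fun y : ℝ => (w (x + y * Complex.I)).im) (𝓝[>] 0)
      (𝓝 (c.im + Real.pi * ProbabilityTheory.cdf ν x)) := fun x => by
    have h1 := (tendsto_integral_log_im hR (hatom x)).const_sub c.im
    rw [sub_neg_eq_add] at h1
    refine h1.congr' ?_
    filter_upwards [self_mem_nhdsWithin] with y hy
    rw [hwz _ (hmem x hy), Complex.sub_im]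
  -- To the right of the support `Im w` tends to `Im c + π`, which is at most `π`; to the left it
  -- tends to `Im c`, which is at least `0`.
  have hcim : c.im = 0 := by
    refine le_antisymm ?_ ?_
    · have h1 := himlim (R + 1)
      rw [hcdf.eq_one _ le_rfl, mul_one] at h1
      have h2 := le_of_tendsto h1 (b := Real.pi) (by
        filter_upwards [self_mem_nhdsWithin] with y hy using him' _ (hmem _ hy))
      linarith
    · have h1 := himlim (-(R + 1))
      rw [hcdf.eq_zero _ le_rfl, mul_zero, add_zero] at h1
      exact ge_of_tendsto h1 (by
        filter_upwards [self_mem_nhdsWithin] with y hy using him _ (hmem _ hy))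
  have hγ : ∀ x : ℝ, ∃ l, Tendsto (fun y : ℝ =>
      (∫ t : ℝ, Complex.log ((t : ℂ) - (x + y * Complex.I)) ∂ν).re) (𝓝[>] 0) (𝓝 l) := fun x => by
    have h1 := (monotoneOn_integral_log_norm hR x).tendsto_nhdsGT ⟨c.re, by
      rintro _ ⟨y, hy, rfl⟩
      exact hlow _ (hmem x hy)⟩
    refine ⟨_, h1.congr' ?_⟩
    filter_upwards [self_mem_nhdsWithin] with y hy
    exact (integral_log_re hR (hmem x hy)).symm
  choose γ hγ using hγ
  have hγlim : IsLyapunovExponent w fun x => γ x - c.re := fun x => by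
    refine ((hγ x).sub_const c.re).congr' ?_
    filter_upwards [self_mem_nhdsWithin] with y hy
    rw [hwz _ (hmem x hy), Complex.sub_re, neg_sub]
  refine ⟨fun x => γ x - c.re, ProbabilityTheory.cdf ν, hγlim, fun x => ?_, inferInstance, ?_, ?_⟩
  · have h1 := (himlim x).div_const Real.pi
    rwa [hcim, zero_add, mul_div_cancel_left₀ _ Real.pi_ne_zero] at h1
  -- Measurability: `γ` is the pointwise limit of continuous functions along the heights `1/(n +
  -- 1)`.
  · have hseq : Tendsto (fun n : ℕ => 1 / ((n : ℝ) + 1)) atTop (𝓝[>] 0) :=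
      tendsto_nhdsWithin_iff.2 ⟨tendsto_one_div_add_atTop_nhds_zero_nat,
        Eventually.of_forall fun n => by simp only [Set.mem_Ioi]; positivity⟩
    refine measurable_of_tendsto_metrizable (f := fun (n : ℕ) (x : ℝ) =>
      -(w (x + (1 / ((n : ℝ) + 1) : ℝ) * Complex.I)).re) (fun n => Continuous.measurable ?_)
      (tendsto_pi_nhds.2 fun x => (hγlim x).comp hseq)
    have hpos : 0 < 1 / ((n : ℝ) + 1) := by positivity
    rw [continuous_iff_continuousAt]
    intro x
    have h1 : ContinuousAt w (x + (1 / ((n : ℝ) + 1) : ℝ) * Complex.I) :=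
      (hw _ (hmem x hpos)).continuousAt
    refine ContinuousAt.neg (Complex.continuous_re.continuousAt.comp ?_)
    exact ContinuousAt.comp (f := fun x : ℝ => (x : ℂ) + (1 / ((n : ℝ) + 1) : ℝ) * Complex.I) h1
      (by fun_prop)
  · have hR0 : 0 ≤ R := by
      obtain ⟨t, ht⟩ := hR.exists
      exact (abs_nonneg t).trans ht
    filter_upwards [hcdf.ae_hasApproxDerivAt (by linarith) hγ] with x ⟨g, hg, hg'⟩
    refine ⟨g, ?_, hg'.sub_const c.re⟩
    simpa only [borelTransform, ProbabilityTheory.measure_cdf, one_div] using hg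

end

/-! ### The Jacobi operator and the solution `f₊` -/

namespace BoundedJacobi

variable (J : BoundedJacobi)

theorem a_pos (n : ℕ) : 0 < J.a n := by
  obtain ⟨C, hC, h⟩ := J.bounded
  rcases Nat.eq_zero_or_pos n with rfl | hn
  · rw [J.a_zero]; exact one_pos
  · exact lt_of_lt_of_le (by positivity) (h n hn).1

theorem exists_bound : ∃ C : ℝ, 0 < C ∧ ∀ n : ℕ, (C + 1)⁻¹ ≤ J.a n ∧ J.a n ≤ C + 1 ∧
    |J.b (n + 1)| ≤ C := by
  obtain ⟨C, hC, h⟩ := J.bounded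
  refine ⟨C, hC, fun n => ?_⟩
  refine ⟨?_, ?_, (h (n + 1) (by omega)).2.2⟩
  · rcases Nat.eq_zero_or_pos n with rfl | hn
    · rw [J.a_zero]; exact inv_le_one_of_one_le₀ (by linarith)
    · exact (h n hn).1
  · rcases Nat.eq_zero_or_pos n with rfl | hn
    · rw [J.a_zero]; linarith
    · exact (h n hn).2.1

theorem a_ne_zero (n : ℕ) : (J.a n : ℂ) ≠ 0 := by exact_mod_cast (J.a_pos n).ne'

theorem tendsto_apply_zero (u : EllTwo) : Tendsto (fun n => u n) atTop (𝓝 0) := by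
  have h2 : (0 : ℝ) < (2 : ENNReal).toReal := by norm_num
  have h1 := ((memℓp_gen_iff h2).1 u.2).tendsto_atTop_zero
  simp only [ENNReal.toReal_ofNat, Real.rpow_ofNat] at h1
  have h3 := h1.sqrt
  simp only [Real.sqrt_sq (norm_nonneg _), Real.sqrt_zero] at h3
  exact tendsto_zero_iff_norm_tendsto_zero.2 h3

/-- Green's formula: the partial sums reduce to a boundary term, which tends to zero for square
summable sequences. This gives self-adjointness. -/
theorem sum_inner_sub_inner (u v : EllTwo) (n : ℕ) :
    ∑ i ∈ Finset.range (n + 1), (inner ℂ (J.op u i) (v i) - inner ℂ (u i) (J.op v i))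
      = J.a (n + 1) * (v n * starRingEnd ℂ (u (n + 1)) - v (n + 1) * starRingEnd ℂ (u n)) := by
  simp only [RCLike.inner_apply, op_apply]
  induction n with
  | zero => simp [act]; ring
  | succ n ih => rw [Finset.sum_range_succ, ih]; simp [act]; ring

theorem isSelfAdjoint_op : IsSelfAdjoint J.op := by
  rw [ContinuousLinearMap.isSelfAdjoint_iff_isSymmetric]
  intro u v
  change inner ℂ (J.op u) v = inner ℂ u (J.op v)
  have h1 := ((lp.hasSum_inner (𝕜 := ℂ) (J.op u) v).sub (lp.hasSum_inner (𝕜 := ℂ) u (J.op v)))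
  have h2 := (tendsto_add_atTop_iff_nat 1).2 h1.tendsto_sum_nat
  simp_rw [J.sum_inner_sub_inner u v] at h2
  obtain ⟨C, hC, h⟩ := J.exists_bound
  have hu := (Complex.continuous_conj.tendsto _).comp (tendsto_apply_zero u)
  rw [map_zero] at hu
  have hv := tendsto_apply_zero v
  have hb : Tendsto (fun n => v n * starRingEnd ℂ (u (n + 1)) - v (n + 1) * starRingEnd ℂ (u n))
      atTop (𝓝 0) := by
    have := (hv.mul ((tendsto_add_atTop_iff_nat 1).2 hu)).sub
      (((tendsto_add_atTop_iff_nat 1).2 hv).mul hu)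
    simpa using this
  have h3 : Tendsto (fun n => (J.a (n + 1) : ℂ) *
      (v n * starRingEnd ℂ (u (n + 1)) - v (n + 1) * starRingEnd ℂ (u n))) atTop (𝓝 0) := by
    refine squeeze_zero_norm (fun n => ?_) (by simpa using hb.norm.const_mul (C + 1))
    rw [norm_mul, Complex.norm_real, Real.norm_of_nonneg (J.a_pos _).le]
    exact mul_le_mul_of_nonneg_right (h _).2.1 (norm_nonneg _)
  exact sub_eq_zero.1 (tendsto_nhds_unique h2 h3)

theorem isUnit_op_sub {z : ℂ} (hz : 0 < z.im) :
    IsUnit (J.op - algebraMap ℂ (EllTwo →L[ℂ] EllTwo) z) := by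
  have h : z ∉ spectrum ℂ J.op := fun hmem => by
    have := J.isSelfAdjoint_op.mem_spectrum_eq_re hmem
    have := congrArg Complex.im this
    rw [Complex.ofReal_im] at this
    exact hz.ne' this
  rw [← neg_sub]
  exact (spectrum.notMem_iff.1 h).neg

/-- The vector `(J - z)⁻¹ δ₁`. -/
noncomputable def resolventVector (z : ℂ) : EllTwo :=
  Ring.inverse (J.op - algebraMap ℂ (EllTwo →L[ℂ] EllTwo) z) (lp.single 2 0 (1 : ℂ))

theorem act_resolventVector {z : ℂ} (hz : 0 < z.im) (n : ℕ) :
    J.act (J.resolventVector z) n - z * J.resolventVector z n = if n = 0 then 1 else 0 := by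
  have h1 := congrArg (fun T : EllTwo →L[ℂ] EllTwo => T (lp.single 2 0 (1 : ℂ)) n)
    (Ring.mul_inverse_cancel _ (J.isUnit_op_sub hz))
  simp only [one_apply_eq_self, lp.single_apply] at h1
  rw [Pi.single_apply] at h1
  rw [← h1]
  simp only [resolventVector, Algebra.algebraMap_eq_smul_one]
  rfl

theorem mPlus_eq (z : ℂ) : J.mPlus z = J.resolventVector z 0 := by
  rw [mPlus, lp.inner_single_left, RCLike.inner_apply, map_one, mul_one]
  rfl

/-- Component `n` of the resolvent vector belongs to the site `n + 1`, and away from the first site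
the resolvent equation is the recursion. At the first site the inhomogeneity `1` plays the part of
`a(0) f₊(0)`. -/
theorem fPlus_succ {z : ℂ} (hz : 0 < z.im) (n : ℕ) :
    J.fPlus z (n + 1) = -J.resolventVector z n := by
  induction n using Nat.strong_induction_on with
  | _ n ih =>
    match n with
    | 0 => rw [fPlus, mPlus_eq]
    | 1 =>
      have h := J.act_resolventVector hz 0
      simp only [act, if_true] at h
      rw [fPlus, ih 0 (by omega), fPlus, J.a_zero, div_eq_iff (J.a_ne_zero _)]
      push_cast
      linear_combination h
    | n + 2 =>
      have h := J.act_resolventVector hz (n + 1)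
      simp only [act, Nat.add_eq_zero_iff, one_ne_zero, and_false, if_false] at h
      rw [fPlus, ih (n + 1) (by omega), ih n (by omega), div_eq_iff (J.a_ne_zero _)]
      linear_combination h

/-- Solutions of the difference equation. -/
def IsSolution (z : ℂ) (s : ℕ → ℂ) : Prop :=
  ∀ n, (J.a (n + 1) : ℂ) * s (n + 2) = (z - J.b (n + 1)) * s (n + 1) - J.a n * s n

theorem isSolution_fPlus (z : ℂ) : J.IsSolution z (J.fPlus z) := fun n => by
  rw [fPlus]
  exact mul_div_cancel₀ _ (J.a_ne_zero _)

variable {J}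

/-- Multiply the recursion by the conjugate of `s (n + 1)` and take imaginary parts; the real
coefficient `b` drops out. -/
theorem IsSolution.im_succ {z : ℂ} {s : ℕ → ℂ} (hs : J.IsSolution z s) (n : ℕ) :
    J.a (n + 1) * (s (n + 2) * starRingEnd ℂ (s (n + 1))).im
      = J.a n * (s (n + 1) * starRingEnd ℂ (s n)).im + z.im * Complex.normSq (s (n + 1)) := by
  have h1 := congrArg (fun w : ℂ => (w * starRingEnd ℂ (s (n + 1))).im) (hs n)
  simp only [Complex.mul_im, Complex.mul_re, Complex.sub_re, Complex.sub_im, Complex.ofReal_re,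
    Complex.ofReal_im, Complex.conj_re, Complex.conj_im, Complex.normSq_apply] at h1 ⊢
  linear_combination h1

theorem div_im_eq (x y : ℂ) : (x / y).im = (x * starRingEnd ℂ y).im / Complex.normSq y := by
  rw [Complex.div_im]
  simp only [Complex.mul_im, Complex.conj_re, Complex.conj_im]
  ring

/-- Constancy of the Wronskian. -/
theorem IsSolution.wronskian {z : ℂ} {s t : ℕ → ℂ} (hs : J.IsSolution z s) (ht : J.IsSolution z t)
    (n : ℕ) : J.a n * (s n * t (n + 1) - s (n + 1) * t n) = s 0 * t 1 - s 1 * t 0 := by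
  induction n with
  | zero => rw [J.a_zero]; push_cast; ring
  | succ n ih =>
    rw [← ih]
    linear_combination s (n + 1) * ht n - t (n + 1) * hs n

theorem IsSolution.apply_zero_eq_zero {z : ℂ} {s : ℕ → ℂ} (hs : J.IsSolution z s) {n : ℕ}
    (h1 : s n = 0) (h2 : s (n + 1) = 0) : s 0 = 0 := by
  induction n with
  | zero => exact h1
  | succ n ih =>
    have h := hs n
    rw [h1, h2, mul_zero, mul_zero, zero_sub, zero_eq_neg] at h
    exact ih ((mul_eq_zero.1 h).resolve_left (J.a_ne_zero _)) h1

/-- The quantity is nondecreasing in `n` with increments `Im z · |f₊|²`, and tends to `0` because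
`f₊` is square summable; hence it is nonpositive. If it vanished once, `f₊` would vanish from the
next site on, and the backward recursion would give `f₊(0) = 0`. -/
theorem fPlus_im_neg {z : ℂ} (hz : 0 < z.im) (n : ℕ) :
    J.a n * (J.fPlus z (n + 1) * starRingEnd ℂ (J.fPlus z n)).im < 0 := by
  set s := J.fPlus z with hs
  have hsol : J.IsSolution z s := J.isSolution_fPlus z
  set W : ℕ → ℝ := fun n => J.a n * (s (n + 1) * starRingEnd ℂ (s n)).im with hW
  have hstep : ∀ n, W (n + 1) = W n + z.im * Complex.normSq (s (n + 1)) := hsol.im_succ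
  have hmono : Monotone W := monotone_nat_of_le_succ fun n => by
    rw [hstep]
    exact le_add_of_nonneg_right (mul_nonneg hz.le (Complex.normSq_nonneg _))
  have hlim : Tendsto (fun n => W (n + 1)) atTop (𝓝 0) := by
    obtain ⟨C, hC, h⟩ := J.exists_bound
    have h0 := tendsto_apply_zero (J.resolventVector z)
    have hb : Tendsto (fun n => ‖s (n + 2)‖ * ‖s (n + 1)‖) atTop (𝓝 0) := by
      have := ((tendsto_add_atTop_iff_nat 1).2 h0).norm.mul h0.norm
      simp only [norm_zero, mul_zero] at this
      refine this.congr fun n => ?_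
      rw [hs, J.fPlus_succ hz, J.fPlus_succ hz, norm_neg, norm_neg]
    refine squeeze_zero_norm (fun n => ?_) (by simpa using hb.const_mul (C + 1))
    rw [norm_mul, Real.norm_of_nonneg (J.a_pos _).le]
    refine mul_le_mul (h _).2.1 ?_ (norm_nonneg _) (by linarith)
    refine (Complex.abs_im_le_norm _).trans_eq ?_
    rw [norm_mul, RCLike.norm_conj]
  have hle : ∀ n, W n ≤ 0 := fun n => ge_of_tendsto hlim (by
    filter_upwards [eventually_ge_atTop n] with m hm
    exact hmono (by omega))
  refine lt_of_le_of_ne (hle n) fun h0 => ?_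
  have hzero : ∀ m, n ≤ m → s (m + 1) = 0 := fun m hm => by
    have h1 : W m = 0 := le_antisymm (hle m) (h0.symm.trans_le (hmono hm))
    have h2 := hle (m + 1)
    rw [hstep, h1, zero_add] at h2
    exact Complex.normSq_eq_zero.1
      (le_antisymm (nonpos_of_mul_nonpos_right h2 hz) (Complex.normSq_nonneg _))
  have h1 := hsol.apply_zero_eq_zero (hzero n le_rfl) (hzero (n + 1) (by omega))
  rw [hs, fPlus] at h1
  exact one_ne_zero h1

theorem fPlus_ne_zero {z : ℂ} (hz : 0 < z.im) (n : ℕ) : J.fPlus z n ≠ 0 := fun h => by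
  have := fPlus_im_neg (J := J) hz n
  simp [h] at this

theorem fPlus_div_im_neg {z : ℂ} (hz : 0 < z.im) (n : ℕ) :
    (J.fPlus z (n + 1) / J.fPlus z n).im < 0 := by
  rw [div_im_eq]
  refine div_neg_of_neg_of_pos ?_ (Complex.normSq_pos.2 (fPlus_ne_zero hz n))
  exact neg_of_mul_neg_right (fPlus_im_neg hz n) (J.a_pos n).le

theorem mul_mPlusAt (J : BoundedJacobi) (n : ℕ) (z : ℂ) :
    (J.a n : ℂ) * J.mPlusAt n z = -(J.fPlus z (n + 1) / J.fPlus z n) := by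
  rw [mPlusAt, mul_neg, mul_div_assoc', mul_div_mul_left _ _ (J.a_ne_zero n)]

theorem differentiableAt_mPlus (J : BoundedJacobi) {z : ℂ} (hz : 0 < z.im) :
    DifferentiableAt ℂ J.mPlus z := by
  have h1 : DifferentiableAt ℂ (fun z : ℂ => J.op - algebraMap ℂ (EllTwo →L[ℂ] EllTwo) z) z :=
    (algebraMapCLM ℂ (EllTwo →L[ℂ] EllTwo)).differentiableAt.const_sub _
  have h2 : DifferentiableAt ℂ
      (fun z : ℂ => Ring.inverse (J.op - algebraMap ℂ (EllTwo →L[ℂ] EllTwo) z)) z :=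
    DifferentiableAt.comp (g := Ring.inverse) z (differentiableAt_inverse (J.isUnit_op_sub hz)) h1
  have h3 := h2.clm_apply (differentiableAt_const (lp.single 2 0 (1 : ℂ) : EllTwo))
  exact ((innerSL ℂ (lp.single 2 0 (1 : ℂ) : EllTwo)).differentiableAt).comp z h3

theorem differentiableAt_fPlus (J : BoundedJacobi) {z : ℂ} (hz : 0 < z.im) (n : ℕ) :
    DifferentiableAt ℂ (fun z => J.fPlus z n) z := by
  induction n using Nat.strong_induction_on with
  | _ n ih =>
    match n with
    | 0 => simp only [fPlus]; exact differentiableAt_const _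
    | 1 => simp only [fPlus]; exact (J.differentiableAt_mPlus hz).neg
    | n + 2 =>
      simp only [fPlus]
      exact (((differentiableAt_id.sub_const _).mul (ih (n + 1) (by omega))).sub
        ((ih n (by omega)).const_mul _)).div_const _

end BoundedJacobi

/-! ### Herglotz functions, orthogonal polynomials and their zeros -/

/-- The function `exp(i log G)` has modulus `exp(-arg G)`, between `exp(-π)` and `1`. Cauchy's
estimate on the disc of radius `Im z / 2` bounds its derivative, whose modulus is `exp(-arg G)`
times that of the logarithmic derivative. -/
theorem norm_logDeriv_le {G : ℂ → ℂ} (hG : IsHerglotz G) {z : ℂ} (hz : 0 < z.im) :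
    ‖logDeriv G z‖ ≤ 2 / z.im * Real.exp Real.pi := by
  have hslit : ∀ ζ ∈ upperHalf, G ζ ∈ Complex.slitPlane := fun ζ hζ => by
    rw [Complex.mem_slitPlane_iff]
    exact Or.inr (ne_of_gt (hG.2 hζ))
  set E : ℂ → ℂ := fun ζ => Complex.exp (Complex.I * Complex.log (G ζ)) with hE
  have hd : ∀ ζ ∈ upperHalf, HasDerivAt E (E ζ * (Complex.I * logDeriv G ζ)) ζ := fun ζ hζ => by
    have h1 := (hG.1.differentiableAt (isOpen_upperHalf.mem_nhds hζ)).hasDerivAt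
    exact ((h1.clog (hslit ζ hζ)).const_mul Complex.I).cexp
  have hnorm : ∀ ζ, ‖E ζ‖ = Real.exp (-(Complex.arg (G ζ))) := fun ζ => by
    rw [hE, Complex.norm_exp]
    simp [Complex.log_im]
  have hsub : Metric.closedBall z (z.im / 2) ⊆ upperHalf := fun ζ hζ => by
    have h1 : ‖ζ - z‖ ≤ z.im / 2 := by simpa [dist_eq_norm] using hζ
    have h2 := (abs_le.1 ((Complex.abs_im_le_norm (ζ - z)).trans h1)).1
    rw [Complex.sub_im] at h2
    simp only [upperHalf, Set.mem_ofPred_eq]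
    linarith
  have hz2 : 0 < z.im / 2 := by positivity
  have hcauchy := Complex.norm_deriv_le_of_forall_mem_sphere_norm_le (f := E) (C := 1) hz2
    (DifferentiableOn.diffContOnCl_ball (U := upperHalf)
      (fun ζ hζ => (hd ζ hζ).differentiableAt.differentiableWithinAt) hsub)
    (fun ζ hζ => by
      rw [hnorm, Real.exp_le_one_iff, neg_nonpos, Complex.arg_nonneg_iff]
      exact le_of_lt (hG.2 (hsub (Metric.sphere_subset_closedBall hζ))))
  rw [(hd z hz).deriv, norm_mul, norm_mul, Complex.norm_I, one_mul, hnorm] at hcauchy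
  have hlow : Real.exp (-Real.pi) ≤ Real.exp (-(Complex.arg (G z))) :=
    Real.exp_le_exp.2 (neg_le_neg (Complex.arg_le_pi _))
  have h1 : Real.exp (-Real.pi) * ‖logDeriv G z‖ ≤ 2 / z.im := by
    refine (mul_le_mul_of_nonneg_right hlow (norm_nonneg _)).trans (hcauchy.trans_eq ?_)
    field_simp
  rw [Real.exp_neg, inv_mul_le_iff₀ (Real.exp_pos _)] at h1
  linarith

namespace BoundedJacobi

open Polynomial in
/-- The orthogonal polynomials: the solution with values `0` and `1` at the sites `0` and `1`. -/
noncomputable def orthoPoly (J : BoundedJacobi) : ℕ → ℂ[X]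
  | 0 => 0
  | 1 => 1
  | n + 2 => C ((J.a (n + 1) : ℂ)⁻¹) *
      ((X - C (J.b (n + 1) : ℂ)) * J.orthoPoly (n + 1) - C (J.a n : ℂ) * J.orthoPoly n)

variable (J : BoundedJacobi)

theorem isSolution_orthoPoly (z : ℂ) : J.IsSolution z fun n => (J.orthoPoly n).eval z := fun n => by
  simp only [orthoPoly, Polynomial.eval_mul, Polynomial.eval_sub, Polynomial.eval_C,
    Polynomial.eval_X]
  rw [mul_inv_cancel_left₀ (J.a_ne_zero _)]

theorem degree_orthoPoly (n : ℕ) :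
    (J.orthoPoly n).degree < n ∧ (J.orthoPoly (n + 1)).degree = n := by
  induction n with
  | zero => simp [orthoPoly]
  | succ n ih =>
    refine ⟨by rw [ih.2]; exact_mod_cast n.lt_succ_self, ?_⟩
    rw [orthoPoly, Polynomial.degree_C_mul (inv_ne_zero (J.a_ne_zero _))]
    have h1 : ((Polynomial.X - Polynomial.C (J.b (n + 1) : ℂ)) * J.orthoPoly (n + 1)).degree
        = ((n + 1 : ℕ) : WithBot ℕ) := by
      rw [Polynomial.degree_mul, Polynomial.degree_X_sub_C, ih.2]
      push_cast
      rw [add_comm]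
    rw [Polynomial.degree_sub_eq_left_of_degree_lt, h1]
    rw [h1, Polynomial.degree_C_mul (J.a_ne_zero _)]
    exact ih.1.trans (by exact_mod_cast n.lt_succ_self)

theorem natDegree_orthoPoly (n : ℕ) : (J.orthoPoly (n + 1)).natDegree = n :=
  Polynomial.natDegree_eq_of_degree_eq_some (J.degree_orthoPoly n).2

/-- The same energy identity as for `f₊`, now started from the value zero at the site `0`, so the
sign is opposite. -/
theorem im_orthoPoly_pos {z : ℂ} (hz : 0 < z.im) (n : ℕ) :
    0 < J.a (n + 1) * ((J.orthoPoly (n + 2)).eval z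
      * starRingEnd ℂ ((J.orthoPoly (n + 1)).eval z)).im := by
  have h := (J.isSolution_orthoPoly z).im_succ
  induction n with
  | zero =>
    rw [h 0]
    simpa [orthoPoly] using hz
  | succ n ih =>
    rw [h (n + 1)]
    exact add_pos_of_pos_of_nonneg ih (mul_nonneg hz.le (Complex.normSq_nonneg _))

theorem eval_orthoPoly_ne_zero {z : ℂ} (hz : 0 < z.im) (n : ℕ) :
    (J.orthoPoly (n + 1)).eval z ≠ 0 := fun h => by
  have := J.im_orthoPoly_pos hz n
  simp [h] at this

theorem orthoPoly_div_im_pos {z : ℂ} (hz : 0 < z.im) (n : ℕ) :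
    0 < ((J.orthoPoly (n + 2)).eval z / (J.orthoPoly (n + 1)).eval z).im := by
  rw [div_im_eq]
  refine div_pos ?_ (Complex.normSq_pos.2 (J.eval_orthoPoly_ne_zero hz n))
  exact pos_of_mul_pos_right (J.im_orthoPoly_pos hz n) (J.a_pos _).le

theorem eval_conj_orthoPoly (z : ℂ) (n : ℕ) :
    (J.orthoPoly n).eval (starRingEnd ℂ z) = starRingEnd ℂ ((J.orthoPoly n).eval z) := by
  induction n using Nat.strong_induction_on with
  | _ n ih =>
    match n with
    | 0 => simp [orthoPoly]
    | 1 => simp [orthoPoly]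
    | n + 2 => simp [orthoPoly, ih n (by omega), ih (n + 1) (by omega)]

theorem im_eq_zero_of_isRoot {r : ℂ} {n : ℕ} (h : (J.orthoPoly (n + 1)).eval r = 0) :
    r.im = 0 := by
  rcases lt_trichotomy r.im 0 with h1 | h1 | h1
  · refine absurd ?_ (J.eval_orthoPoly_ne_zero (z := starRingEnd ℂ r) (by simpa using h1) n)
    rw [eval_conj_orthoPoly, h, map_zero]
  · exact h1
  · exact absurd h (J.eval_orthoPoly_ne_zero h1 n)

/-- For `|z| ≥ 3C + 2` one has `|z - b| ≥ 2(C + 1)`, which outweighs the two off-diagonal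
coefficients, each at most `C + 1`. Growth from the value `1` at the first site excludes zeros. -/
theorem norm_eval_orthoPoly_mono {C : ℝ} (hC : 0 < C) (hJ : ∀ n : ℕ, (C + 1)⁻¹ ≤ J.a n ∧
    J.a n ≤ C + 1 ∧ |J.b (n + 1)| ≤ C) {z : ℂ} (hz : 3 * C + 2 ≤ ‖z‖) (n : ℕ) :
    ‖(J.orthoPoly n).eval z‖ ≤ ‖(J.orthoPoly (n + 1)).eval z‖ := by
  induction n with
  | zero => simp [orthoPoly]
  | succ n ih =>
    have h1 := J.isSolution_orthoPoly z n
    have h2 : ‖z‖ - C ≤ ‖z - J.b (n + 1)‖ := by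
      refine le_trans ?_ (norm_sub_norm_le _ _)
      rw [Complex.norm_real, Real.norm_eq_abs]
      linarith [(hJ n).2.2]
    have h3 := norm_sub_norm_le ((z - J.b (n + 1)) * (J.orthoPoly (n + 1)).eval z)
      (J.a n * (J.orthoPoly n).eval z)
    rw [← h1, norm_mul, norm_mul, norm_mul, Complex.norm_real, Complex.norm_real,
      Real.norm_of_nonneg (J.a_pos _).le, Real.norm_of_nonneg (J.a_pos _).le] at h3
    have h4 := norm_nonneg ((J.orthoPoly (n + 1)).eval z)
    have h5 : (2 * C + 2) * ‖(J.orthoPoly (n + 1)).eval z‖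
        ≤ ‖z - J.b (n + 1)‖ * ‖(J.orthoPoly (n + 1)).eval z‖ := by gcongr; linarith
    have h6 : J.a n * ‖(J.orthoPoly n).eval z‖ ≤ (C + 1) * ‖(J.orthoPoly (n + 1)).eval z‖ :=
      mul_le_mul (hJ n).2.1 ih (norm_nonneg _) (by linarith)
    have h7 : J.a (n + 1) * ‖(J.orthoPoly (n + 2)).eval z‖
        ≤ (C + 1) * ‖(J.orthoPoly (n + 2)).eval z‖ :=
      mul_le_mul_of_nonneg_right (hJ _).2.1 (norm_nonneg _)
    have h8 : (C + 1) * ‖(J.orthoPoly (n + 1)).eval z‖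
        ≤ (C + 1) * ‖(J.orthoPoly (n + 2)).eval z‖ := by linarith
    exact le_of_mul_le_mul_left h8 (by linarith)

/-- The zeros of all orthogonal polynomials lie in a common bounded interval. -/
theorem exists_root_bound : ∃ B : ℝ, 0 < B ∧ ∀ (n : ℕ) (r : ℂ),
    (J.orthoPoly (n + 1)).eval r = 0 → ∃ t : ℝ, |t| ≤ B ∧ r = t := by
  obtain ⟨C, hC, hJ⟩ := J.exists_bound
  refine ⟨3 * C + 2, by positivity, fun n r hr => ?_⟩
  have hre : r = (r.re : ℂ) := by
    rw [Complex.ext_iff]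
    simp [J.im_eq_zero_of_isRoot hr]
  refine ⟨r.re, ?_, hre⟩
  by_contra hcon
  have hnorm : 3 * C + 2 ≤ ‖r‖ := (not_le.1 hcon).le.trans (Complex.abs_re_le_norm r)
  have hmono := monotone_nat_of_le_succ (J.norm_eval_orthoPoly_mono hC hJ hnorm)
  have h1 := hmono (show 1 ≤ n + 1 by omega)
  simp only [hr, norm_zero] at h1
  simp [orthoPoly] at h1
  linarith

/-- The logarithmic derivative of an orthogonal polynomial in terms of its zeros. -/
theorem logDeriv_orthoPoly {B : ℝ} (hB : ∀ (n : ℕ) (r : ℂ),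
    (J.orthoPoly (n + 1)).eval r = 0 → ∃ t : ℝ, |t| ≤ B ∧ r = t) (n : ℕ) :
    ∃ x : Fin n → Set.Icc (-B) B, ∀ z : ℂ, 0 < z.im →
      logDeriv (fun z => (J.orthoPoly (n + 1)).eval z) z = -∑ i, (((x i : ℝ) : ℂ) - z)⁻¹ := by
  set p := J.orthoPoly (n + 1) with hp
  have hp0 : p ≠ 0 := fun h => by
    have := (J.degree_orthoPoly n).2
    rw [← hp, h, Polynomial.degree_zero] at this
    exact absurd this (by simp)
  have hsplits := IsAlgClosed.splits p
  have hlen : p.roots.toList.length = n := by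
    rw [Multiset.length_toList, ← hsplits.natDegree_eq_card_roots, hp, J.natDegree_orthoPoly]
  -- The zeros, listed with multiplicity, are taken as points of the compact interval, so that their
  -- counting measures live on a compact space.
  have hx : ∀ i : Fin n, ∃ t : Set.Icc (-B) B,
      p.roots.toList.get (Fin.cast hlen.symm i) = ((t : ℝ) : ℂ) := fun i => by
    have hmem : p.roots.toList.get (Fin.cast hlen.symm i) ∈ p.roots :=
      Multiset.mem_toList.1 (List.get_mem _ _)
    obtain ⟨t, ht, hrt⟩ := hB n _ ((Polynomial.mem_roots hp0).1 hmem)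
    exact ⟨⟨t, abs_le.1 ht⟩, hrt⟩
  choose x hx using hx
  refine ⟨x, fun z hz => ?_⟩
  have h1 := hsplits.eval_derivative_div_eval_of_ne_zero (J.eval_orthoPoly_ne_zero hz n)
  have h2 : (Multiset.map (fun r => 1 / (z - r)) p.roots).sum
      = ∑ i : Fin n, 1 / (z - p.roots.toList.get (Fin.cast hlen.symm i)) := by
    conv_lhs => rw [← Multiset.coe_toList p.roots]
    rw [Multiset.map_coe, Multiset.sum_coe, ← Fin.sum_univ_getElem]
    refine Fintype.sum_equiv (finCongr (by rw [List.length_map, hlen])) _ _ fun i => ?_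
    simp
  rw [logDeriv_apply, Polynomial.deriv, h1, h2, ← Finset.sum_neg_distrib]
  refine Finset.sum_congr rfl fun i _ => ?_
  rw [hx, one_div, ← inv_neg, neg_sub]

variable {J}

theorem isHerglotz_neg_fPlus_div (J : BoundedJacobi) (n : ℕ) :
    IsHerglotz fun z => -(J.fPlus z (n + 1) / J.fPlus z n) := by
  refine ⟨fun z hz => DifferentiableAt.differentiableWithinAt ?_, fun z hz => ?_⟩
  · exact ((J.differentiableAt_fPlus hz _).div (J.differentiableAt_fPlus hz _)
      (fPlus_ne_zero hz n)).neg
  · simp only [upperHalf, Set.mem_ofPred_eq, Complex.neg_im]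
    linarith [fPlus_div_im_neg (J := J) hz n]

theorem isHerglotz_orthoPoly_div_sub (J : BoundedJacobi) (n : ℕ) :
    IsHerglotz fun z => (J.orthoPoly (n + 2)).eval z / (J.orthoPoly (n + 1)).eval z
      - J.fPlus z (n + 2) / J.fPlus z (n + 1) := by
  refine ⟨fun z hz => DifferentiableAt.differentiableWithinAt ?_, fun z hz => ?_⟩
  · refine DifferentiableAt.sub ?_ ?_
    · exact (Polynomial.differentiableAt _).div (Polynomial.differentiableAt _)
        (J.eval_orthoPoly_ne_zero hz n)
    · exact (J.differentiableAt_fPlus hz _).div (J.differentiableAt_fPlus hz _)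
        (fPlus_ne_zero hz _)
  · simp only [upperHalf, Set.mem_ofPred_eq, Complex.sub_im]
    linarith [fPlus_div_im_neg (J := J) hz (n + 1), J.orthoPoly_div_im_pos hz n]

/-- The Wronskian of `f₊` and the orthogonal polynomials is `1`, so the product of `f₊(n+1)`,
`p(n+1)` and the difference of quotients is the constant `1/a(n+1)`, whose logarithmic derivative
vanishes. -/
theorem logDeriv_fPlus (J : BoundedJacobi) (n : ℕ) {z : ℂ} (hz : 0 < z.im) :
    logDeriv (fun z => J.fPlus z (n + 1)) z
      = -logDeriv (fun z => (J.orthoPoly (n + 1)).eval z) z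
        - logDeriv (fun z => (J.orthoPoly (n + 2)).eval z / (J.orthoPoly (n + 1)).eval z
            - J.fPlus z (n + 2) / J.fPlus z (n + 1)) z := by
  set H : ℂ → ℂ := fun z => (J.orthoPoly (n + 2)).eval z / (J.orthoPoly (n + 1)).eval z
    - J.fPlus z (n + 2) / J.fPlus z (n + 1) with hH
  have hprod : ∀ ζ ∈ upperHalf, J.fPlus ζ (n + 1) * ((J.orthoPoly (n + 1)).eval ζ * H ζ)
      = (J.a (n + 1) : ℂ)⁻¹ := fun ζ hζ => by
    have h1 := (J.isSolution_fPlus ζ).wronskian (J.isSolution_orthoPoly ζ) (n + 1)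
    simp only [orthoPoly.eq_1, orthoPoly.eq_2, Polynomial.eval_zero, Polynomial.eval_one, mul_one,
      mul_zero, sub_zero, fPlus.eq_1] at h1
    have h2 : J.fPlus ζ (n + 1) ≠ 0 := fPlus_ne_zero hζ _
    have h3 := J.eval_orthoPoly_ne_zero hζ n
    refine eq_inv_of_mul_eq_one_right ?_
    rw [← h1, hH]
    field_simp
  have hHz : H z ≠ 0 := fun h0 => by
    have := (isHerglotz_orthoPoly_div_sub J n).2 hz
    simp only [upperHalf, Set.mem_ofPred_eq] at this
    change 0 < (H z).im at this
    rw [h0, Complex.zero_im] at this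
    exact lt_irrefl _ this
  have hHd : DifferentiableAt ℂ H z :=
    (isHerglotz_orthoPoly_div_sub J n).1.differentiableAt (isOpen_upperHalf.mem_nhds hz)
  have hPd : DifferentiableAt ℂ (fun z => (J.orthoPoly (n + 1)).eval z) z :=
    Polynomial.differentiableAt _
  have hP := J.eval_orthoPoly_ne_zero hz n
  have h1 := logDeriv_mul (g := fun z => (J.orthoPoly (n + 1)).eval z * H z) z (fPlus_ne_zero (J := J) hz (n + 1)) (mul_ne_zero hP hHz)
    (J.differentiableAt_fPlus hz _) (hPd.mul hHd)
  have h2 := logDeriv_mul z hP hHz hPd hHd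
  have h3 : logDeriv (fun z => J.fPlus z (n + 1) * ((J.orthoPoly (n + 1)).eval z * H z)) z = 0 := by
    have he : (fun z => J.fPlus z (n + 1) * ((J.orthoPoly (n + 1)).eval z * H z))
        =ᶠ[𝓝 z] fun _ => (J.a (n + 1) : ℂ)⁻¹ := by
      filter_upwards [isOpen_upperHalf.mem_nhds hz] with ζ hζ using hprod ζ hζ
    rw [logDeriv_apply, he.deriv_eq, deriv_const, zero_div]
  rw [h3] at h1
  linear_combination -h1 - h2

theorem logDeriv_div_fPlus (J : BoundedJacobi) (n : ℕ) {z : ℂ} (hz : 0 < z.im) :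
    logDeriv (fun z => -(J.fPlus z (n + 1) / J.fPlus z n)) z
      = logDeriv (fun z => J.fPlus z (n + 1)) z - logDeriv (fun z => J.fPlus z n) z := by
  have h1 := logDeriv_div z (fPlus_ne_zero (J := J) hz (n + 1)) (fPlus_ne_zero hz n)
    (J.differentiableAt_fPlus hz _) (J.differentiableAt_fPlus hz _)
  rw [← h1, logDeriv_apply, logDeriv_apply, deriv.fun_neg, neg_div_neg_eq]

theorem hasDerivAt_wPlus (J : BoundedJacobi) (N : ℕ) {z : ℂ} (hz : 0 < z.im) :
    HasDerivAt (J.wPlus N) ((1 / (N : ℂ)) * (logDeriv (fun z => J.fPlus z (N + 1)) z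
      - logDeriv (fun z => J.fPlus z 1) z)) z := by
  have hterm : ∀ n, HasDerivAt (fun z => Complex.log ((J.a n : ℂ) * J.mPlusAt n z))
      (logDeriv (fun z => J.fPlus z (n + 1)) z - logDeriv (fun z => J.fPlus z n) z) z := fun n => by
    simp_rw [mul_mPlusAt]
    have hH := isHerglotz_neg_fPlus_div J n
    rw [← J.logDeriv_div_fPlus n hz]
    refine (hH.1.differentiableAt (isOpen_upperHalf.mem_nhds hz)).hasDerivAt.clog ?_
    rw [Complex.mem_slitPlane_iff]
    exact Or.inr (ne_of_gt (hH.2 hz))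
  have hsum := (HasDerivAt.fun_sum (u := Finset.Icc 1 N) fun n _ => hterm n).const_mul (1 / (N : ℂ))
  have htel : ∑ n ∈ Finset.Icc 1 N, (logDeriv (fun z => J.fPlus z (n + 1)) z
      - logDeriv (fun z => J.fPlus z n) z)
      = logDeriv (fun z => J.fPlus z (N + 1)) z - logDeriv (fun z => J.fPlus z 1) z := by
    rw [← Finset.Ico_add_one_right_eq_Icc]
    exact Finset.sum_Ico_sub (fun n => logDeriv (fun z => J.fPlus z n) z) (by omega)
  rw [htel] at hsum
  exact hsum

/-- The derivative of `w₊^{(N)}` differs from the Borel transform of a normalized zero counting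
measure by `O(1/N)`. -/
theorem norm_deriv_wPlus_sub_le (J : BoundedJacobi) {B : ℝ} (hB : ∀ (n : ℕ) (r : ℂ),
    (J.orthoPoly (n + 1)).eval r = 0 → ∃ t : ℝ, |t| ≤ B ∧ r = t) (N : ℕ) :
    ∃ x : Fin N → Set.Icc (-B) B, ∀ z : ℂ, 0 < z.im →
      ‖deriv (J.wPlus N) z - (1 / (N : ℂ)) * ∑ i, (((x i : ℝ) : ℂ) - z)⁻¹‖
        ≤ (1 / (N : ℝ)) * (2 * (2 / z.im * Real.exp Real.pi)) := by
  obtain ⟨x, hx⟩ := J.logDeriv_orthoPoly hB N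
  refine ⟨x, fun z hz => ?_⟩
  rw [(J.hasDerivAt_wPlus N hz).deriv, J.logDeriv_fPlus N hz, hx z hz, neg_neg, ← mul_sub, norm_mul]
  have h1 := norm_logDeriv_le (isHerglotz_orthoPoly_div_sub J N) hz
  -- As `f₊(0) = 1`, the quotient at `n = 0` is `f₊(1)` itself.
  have h2 := norm_logDeriv_le (isHerglotz_neg_fPlus_div J 0) hz
  rw [J.logDeriv_div_fPlus 0 hz] at h2
  have h3 : logDeriv (fun z => J.fPlus z 0) z = 0 := by
    simp only [fPlus]
    simp [logDeriv_apply]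
  rw [h3, sub_zero, zero_add] at h2
  have h4 : ‖(1 / (N : ℂ))‖ = 1 / (N : ℝ) := by simp
  rw [h4]
  refine mul_le_mul_of_nonneg_left ?_ (by positivity)
  have h5 : ∀ s p q : ℂ, s - p - q - s = -(p + q) := fun s p q => by ring
  rw [h5, norm_neg, two_mul]
  exact (norm_add_le _ _).trans (add_le_add h1 h2)

end BoundedJacobi

/-! ### The limit of the zero counting measures -/

/-- The normalized counting measure of a finite family of points. -/
noncomputable def countingProbability {X : Type*} [MeasurableSpace X] (n : ℕ) (x : Fin (n + 1) → X) :
    ProbabilityMeasure X :=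
  ⟨((n + 1 : ℕ) : ENNReal)⁻¹ • ∑ i, Measure.dirac (x i), ⟨by
    simp only [Measure.smul_apply, Measure.finsetSum_apply, measure_univ, Finset.sum_const,
      Finset.card_univ, Fintype.card_fin, nsmul_eq_mul, mul_one, smul_eq_mul]
    exact ENNReal.inv_mul_cancel (by simp) (ENNReal.natCast_ne_top _)⟩⟩

theorem integral_countingProbability {X : Type*} [TopologicalSpace X] [MeasurableSpace X]
    [OpensMeasurableSpace X] (n : ℕ) (x : Fin (n + 1) → X) (F : BoundedContinuousFunction X ℂ) :
    ∫ t, F t ∂(countingProbability n x : Measure X) = (1 / ((n + 1 : ℕ) : ℂ)) * ∑ i, F (x i) := by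
  have hm : StronglyMeasurable F := F.continuous.stronglyMeasurable
  change ∫ t, F t ∂(((n + 1 : ℕ) : ENNReal)⁻¹ • ∑ i, Measure.dirac (x i)) = _
  rw [integral_smul_measure, integral_finsetSum_measure fun i _ => F.integrable _]
  simp_rw [integral_dirac' _ _ hm]
  rw [ENNReal.toReal_inv, ENNReal.toReal_natCast, Complex.real_smul, Complex.ofReal_inv, one_div]
  simp

namespace BoundedJacobi

variable {J : BoundedJacobi}

theorem tendsto_deriv_wPlus {N : ℕ → ℕ} {w : ℂ → ℂ} (hw : J.IsLimitWPlus N w) {z : ℂ}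
    (hz : 0 < z.im) : Tendsto (fun j => deriv (J.wPlus (N j)) z) atTop (𝓝 (deriv w z)) := by
  have h1 := (tendstoLocallyUniformlyOn_iff_forall_isCompact isOpen_upperHalf).2 hw.2
  have h2 := h1.deriv (Eventually.of_forall fun j z hz =>
    (J.hasDerivAt_wPlus (N j) hz).differentiableAt.differentiableWithinAt) isOpen_upperHalf
  exact h2.tendsto_at hz

theorem tendsto_wPlus {N : ℕ → ℕ} {w : ℂ → ℂ} (hw : J.IsLimitWPlus N w) {z : ℂ}
    (hz : 0 < z.im) : Tendsto (fun j => J.wPlus (N j) z) atTop (𝓝 (w z)) :=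
  (hw.2 {z} (Set.singleton_subset_iff.2 hz) isCompact_singleton).tendsto_at (Set.mem_singleton z)

theorem wPlus_im_le (J : BoundedJacobi) (N : ℕ) (z : ℂ) : (J.wPlus N z).im ≤ Real.pi := by
  have h1 : (1 / (N : ℂ)) = ((1 / (N : ℝ) : ℝ) : ℂ) := by push_cast; rfl
  rw [wPlus, h1, Complex.im_ofReal_mul, Complex.im_sum]
  have h2 : ∑ n ∈ Finset.Icc 1 N, (Complex.log ((J.a n : ℂ) * J.mPlusAt n z)).im ≤ N * Real.pi := by
    refine (Finset.sum_le_card_nsmul _ _ Real.pi fun n _ => ?_).trans_eq ?_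
    · rw [Complex.log_im]; exact Complex.arg_le_pi _
    · simp
  rcases Nat.eq_zero_or_pos N with rfl | hN
  · simp [Real.pi_pos.le]
  · have hN' : (0 : ℝ) < N := by exact_mod_cast hN
    calc 1 / (N : ℝ) * _ ≤ 1 / (N : ℝ) * (N * Real.pi) := by gcongr
      _ = Real.pi := by field_simp

/-- The real parts of the logarithms telescope, and `|f₊(N+1)|` is at most the norm of the resolvent
vector, independently of `N`. The bound is thus a constant over `N`, and the limit has nonpositive
real part. -/
theorem wPlus_re_le (J : BoundedJacobi) (N : ℕ) {z : ℂ} (hz : 0 < z.im) :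
    (J.wPlus N z).re ≤ 1 / (N : ℝ) *
      (Real.log ‖J.resolventVector z‖ - Real.log ‖J.fPlus z 1‖) := by
  have h1 : (1 / (N : ℂ)) = ((1 / (N : ℝ) : ℝ) : ℂ) := by push_cast; rfl
  rw [wPlus, h1, Complex.re_ofReal_mul, Complex.re_sum]
  refine mul_le_mul_of_nonneg_left ?_ (by positivity)
  have h2 : ∀ n, (Complex.log ((J.a n : ℂ) * J.mPlusAt n z)).re
      = Real.log ‖J.fPlus z (n + 1)‖ - Real.log ‖J.fPlus z n‖ := fun n => by
    rw [Complex.log_re, mul_mPlusAt, norm_neg, norm_div,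
      Real.log_div (norm_ne_zero_iff.2 (fPlus_ne_zero hz _))
        (norm_ne_zero_iff.2 (fPlus_ne_zero hz _))]
  simp_rw [h2]
  rw [← Finset.Ico_add_one_right_eq_Icc,
    Finset.sum_Ico_sub (fun n => Real.log ‖J.fPlus z n‖) (by omega)]
  refine sub_le_sub_right (Real.log_le_log (norm_pos_iff.2 (fPlus_ne_zero hz _)) ?_) _
  rw [J.fPlus_succ hz, norm_neg]
  exact lp.norm_apply_le_norm (by norm_num) _ _

theorem limit_im_le {N : ℕ → ℕ} {w : ℂ → ℂ} (hw : J.IsLimitWPlus N w) {z : ℂ} (hz : 0 < z.im) :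
    (w z).im ≤ Real.pi :=
  le_of_tendsto ((Complex.continuous_im.tendsto _).comp (tendsto_wPlus hw hz))
    (Eventually.of_forall fun j => J.wPlus_im_le (N j) z)

theorem limit_re_le {N : ℕ → ℕ} (hN : Tendsto N atTop atTop) {w : ℂ → ℂ}
    (hw : J.IsLimitWPlus N w) {z : ℂ} (hz : 0 < z.im) : (w z).re ≤ 0 := by
  have h1 : Tendsto (fun j => 1 / (N j : ℝ) *
      (Real.log ‖J.resolventVector z‖ - Real.log ‖J.fPlus z 1‖)) atTop (𝓝 0) := by
    have := (tendsto_one_div_atTop_nhds_zero_nat.comp hN).mul_const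
      (Real.log ‖J.resolventVector z‖ - Real.log ‖J.fPlus z 1‖)
    rwa [zero_mul] at this
  exact le_of_tendsto_of_tendsto' ((Complex.continuous_re.tendsto _).comp (tendsto_wPlus hw hz)) h1
    fun j => J.wPlus_re_le (N j) hz

/-- The derivative of a limit of the functions `w₊^{(N)}` is the Borel transform of a limit of zero
counting measures. -/
theorem exists_hasDerivAt_limit {N : ℕ → ℕ} (hN : Tendsto N atTop atTop) {w : ℂ → ℂ}
    (hw : J.IsLimitWPlus N w) :
    ∃ (ν : Measure ℝ) (B : ℝ), IsProbabilityMeasure ν ∧ (∀ᵐ t ∂ν, |t| ≤ B) ∧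
      ∀ z ∈ upperHalf, HasDerivAt w (∫ t : ℝ, ((t : ℂ) - z)⁻¹ ∂ν) z := by
  obtain ⟨B, -, hB⟩ := J.exists_root_bound
  choose x hx using J.norm_deriv_wPlus_sub_le hB
  -- The shift `N j - 1 + 1` keeps the family nonempty; it equals `N j` as soon as `N j ≥ 1`.
  let P : ℕ → ProbabilityMeasure (Set.Icc (-B) B) := fun j =>
    countingProbability (N j - 1) fun i => x (N j - 1 + 1) i
  -- By compactness of the space of probability measures on the interval, the measures converge
  -- along an ultrafilter. This is enough, since the derivatives of `w₊^{(N j)}` converge along the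
  -- whole sequence.
  let U : Ultrafilter ℕ := Ultrafilter.of atTop
  have hU : (U : Filter ℕ) ≤ atTop := Ultrafilter.of_le atTop
  obtain ⟨ν₀, -, hν₀⟩ := isCompact_univ.ultrafilter_le_nhds (U.map P) (by simp)
  have hlim : Tendsto P U (𝓝 ν₀) := hν₀
  refine ⟨(ν₀ : Measure (Set.Icc (-B) B)).map Subtype.val, B,
    Measure.isProbabilityMeasure_map measurable_subtype_coe.aemeasurable, ?_, fun z hz => ?_⟩
  · rw [ae_map_iff measurable_subtype_coe.aemeasurable (measurableSet_le (by fun_prop) (by fun_prop))]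
    exact Eventually.of_forall fun t => abs_le.2 t.2
  have hz' : 0 < z.im := hz
  let F : BoundedContinuousFunction (Set.Icc (-B) B) ℂ :=
    BoundedContinuousFunction.mkOfCompact
      ⟨fun t => (((t : ℝ) : ℂ) - z)⁻¹, (continuous_inv_sub hz').comp continuous_subtype_val⟩
  have hF : ∫ t : ℝ, ((t : ℂ) - z)⁻¹ ∂((ν₀ : Measure (Set.Icc (-B) B)).map Subtype.val)
      = ∫ t, F t ∂(ν₀ : Measure (Set.Icc (-B) B)) :=
    integral_map measurable_subtype_coe.aemeasurable (continuous_inv_sub hz').aestronglyMeasurable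
  have h1 := (ProbabilityMeasure.tendsto_iff_forall_integral_rclike_tendsto ℂ).1 hlim F
  have h2 : Tendsto (fun j => deriv (J.wPlus (N j)) z
      - ∫ t, F t ∂(P j : Measure (Set.Icc (-B) B))) U (𝓝 0) := by
    have h3 : Tendsto (fun j => 1 / (N j : ℝ) * (2 * (2 / z.im * Real.exp Real.pi))) atTop
        (𝓝 0) := by
      have := (tendsto_one_div_atTop_nhds_zero_nat.comp hN).mul_const
        (2 * (2 / z.im * Real.exp Real.pi))
      rwa [zero_mul] at this
    refine squeeze_zero_norm' ?_ (h3.mono_left hU)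
    filter_upwards [hU (hN.eventually (eventually_ge_atTop 1))] with j hj
    have hj' : N j - 1 + 1 = N j := Nat.sub_add_cancel hj
    rw [integral_countingProbability]
    have := hx (N j - 1 + 1) z hz'
    rw [hj'] at this ⊢
    exact this
  have h4 := h2.add h1
  simp only [sub_add_cancel, zero_add] at h4
  have h5 := tendsto_nhds_unique ((tendsto_deriv_wPlus hw hz').mono_left hU) h4
  rw [hF, ← h5]
  exact (hw.1.1.differentiableAt (isOpen_upperHalf.mem_nhds hz)).hasDerivAt

end BoundedJacobi

theorem theorem4p2 (J : BoundedJacobi) (N : ℕ → ℕ) (hN : Tendsto N atTop atTop)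
    (w : ℂ → ℂ) (hw : J.IsLimitWPlus N w) :
    ∃ (γ : ℝ → ℝ) (k : StieltjesFunction ℝ),
      IsLyapunovExponent w γ ∧ IsIntegratedDensityOfStates w k ∧
      IsProbabilityMeasure k.measure ∧ Measurable γ ∧
      ∀ᵐ x : ℝ, ∃ g : ℂ,
        Tendsto (fun y : ℝ => borelTransform k.measure (x + y * Complex.I)) (𝓝[>] 0) (𝓝 g) ∧
        HasApproxDerivAt γ (-g.re) x := by
  obtain ⟨ν, B, hν, hB, hd⟩ := BoundedJacobi.exists_hasDerivAt_limit hN hw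
  exact exists_boundary_values hB hd (fun z hz => BoundedJacobi.limit_re_le hN hw hz)
    (fun z hz => le_of_lt (hw.1.2 hz)) fun z hz => BoundedJacobi.limit_im_le hw hz
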